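/- Let $R$ (red points) and $B$ (blue points) be disjoint finite point sets in the plane such that $S=R\cup B$ is in general position, i.e. no three points of $S$ are collinear. Write $\mathrm{CH}(S)$ for the convex hull of $S$. Definitions. A \emph{run} of $S$ is a maximal set of consecutive points of $S$ of the same colour on the boundary of $\mathrm{CH}(S)$; let $\mathtt r(S)$ and $\mathtt b(S)$ be the numbers of red and of blue runs. A \emph{Hamiltonian alternating path} on $S$ is a path that visits every point of $S$ exactly once and whose edges are straight-line segments joining points of different colours. Two edges \emph{cross} if they share a point lying in the relative interior of both, and the path is \emph{1-plane} if each of its edges has at most one crossing. For a point $x\in S$ on the boundary of $\mathrm{CH}(S)$, the counterclockwise (clockwise) radial order of $S\setminus\{x\}$ around $x$ is the order $p_1,p_2,\dots$ in which a ray rotating counterclockwise (clockwise) around $x$ from outside $\mathrm{CH}(S)$ meets these points. When $|R|=|B|$, the counterclockwise (clockwise) \emph{balance point} of $x$ is the first $p_j$ in this order such that $\{x,p_1,\dots,p_j\}$ contains as many red as blue points. For a red point $r$ and a blue point $b$ of $S$ on the boundary of $\mathrm{CH}(S)$, the triple $(S,r,b)$ is \emph{special} if: the neighbours of $r$ on the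 boundary of $\mathrm{CH}(S)$ are red and those of $b$ are blue; the counterclockwise and the clockwise balance points of $r$ are both $b$; and the counterclockwise and the clockwise balance points of $b$ are both $r$. Otherwise $(S,r,b)$ is \emph{non-special}. Statement. Let $r$ be an arbitrary red point on the boundary of $\mathrm{CH}(S)$. (i) If $|R|=|B|=n\ge 1$ and $b$ is a blue point on the boundary of $\mathrm{CH}(S)$ such that $(S,r,b)$ is non-special, then $\mathtt r(S)=\mathtt b(S)$ and there is a 1-plane Hamiltonian alternating path on $S$ with endpoints $r$ and $b$ and with at most $n-\mathtt r(S)=n-\mathtt b(S)$ crossings. (ii) If $|R|=|B|+1=n+1\ge 2$ and $r'\in R\setminus\{r\}$ is another red point on the boundary of $\mathrm{CH}(S)$, then there is a 1-plane Hamiltonian alternating path on $S$ with endpoints $r$ and $r'$ and with at most $n-\mathtt b(S)$ crossings. -/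

import Mathlib

/-- The Euclidean plane. -/
abbrev Plane : Type := EuclideanSpace ℝ (Fin 2)

/-- A point set is in general position if no three of its points lie on a common line. -/
def InGeneralPosition (S : Set Plane) : Prop :=
  ∀ p ∈ S, ∀ q ∈ S, ∀ t ∈ S, p ≠ q → q ≠ t → p ≠ t → ¬ Collinear ℝ ({p, q, t} : Set Plane)

/-- The points of `S` on the boundary of its convex hull. -/
def hullPoints (S : Set Plane) : Set Plane := {p | p ∈ S ∧ p ∈ frontier (convexHull ℝ S)}

/-- `p` and `q` are neighbours (consecutive points of `S`) on the boundary of the convex hull of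
`S`: they are distinct points of `S`, the segment between them runs along the boundary, and there
is no further point of `S` between them. -/
def HullNeighbors (S : Set Plane) (p q : Plane) : Prop :=
  p ∈ S ∧ q ∈ S ∧ p ≠ q ∧ segment ℝ p q ⊆ frontier (convexHull ℝ S) ∧
    ∀ t ∈ S, t ∉ openSegment ℝ p q

theorem HullNeighbors.symm {S : Set Plane} {p q : Plane} (h : HullNeighbors S p q) :
    HullNeighbors S q p := by
  obtain ⟨hp, hq, hne, hs, ho⟩ := h
  refine ⟨hq, hp, hne.symm, ?_, ?_⟩
  · rw [segment_symm]; exact hs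
  · rw [openSegment_symm]; exact ho

/-- The graph on the hull points of `S` that have colour `C` (the set of all points of that
colour), two of them being joined when they are consecutive on the hull boundary of `S`. -/
def runGraph (S C : Set Plane) : SimpleGraph {p : Plane // p ∈ hullPoints S ∧ p ∈ C} where
  Adj p q := HullNeighbors S p q
  symm := ⟨fun _ _ h => h.symm⟩
  loopless := ⟨fun _ h => h.2.2.1 rfl⟩

/-- The number of runs of `S` of colour `C`. A run is a maximal set of consecutive points of colour
`C` on the hull boundary of `S`, that is, a connected component of `runGraph S C`. -/
noncomputable def numRuns (S C : Set Plane) : ℕ := Nat.card (runGraph S C).ConnectedComponent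

/-- Twice the signed area of the triangle `x p q`: positive iff the turn `x, p, q` is
counterclockwise, negative iff it is clockwise. -/
def orient (x p q : Plane) : ℝ :=
  (p 0 - x 0) * (q 1 - x 1) - (p 1 - x 1) * (q 0 - x 0)

/-- For `x` on the hull boundary of a set in general position, all other points are seen from `x`
within an angle less than `π`, and this is their counterclockwise radial order around `x`; its
first element is a hull neighbour of `x`. -/
def CcwBefore (x p q : Plane) : Prop := 0 < orient x p q

/-- The clockwise radial order around a hull point `x`. -/
def CwBefore (x p q : Plane) : Prop := orient x p q < 0

/-- The set `{x, p₁, …, q}` consisting of `x` and of the points of `S \ {x}` up to and including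
`q` in the radial order `before` around `x`. -/
def radialInitial (S : Set Plane) (before : Plane → Plane → Plane → Prop) (x q : Plane) :
    Set Plane :=
  {p | p = x ∨ (p ∈ S ∧ p ≠ x ∧ (before x p q ∨ p = q))}

/-- The set `X` contains as many red as blue points. -/
def EquallyColored (R B X : Set Plane) : Prop := (X ∩ R).ncard = (X ∩ B).ncard

/-- `q` is the first point of `(R ∪ B) \ {x}`, in the radial order `before` around `x`, for which
`{x, p₁, …, q}` contains as many red as blue points. -/
def IsFirstBalanced (R B : Set Plane) (before : Plane → Plane → Plane → Prop)
    (x q : Plane) : Prop :=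
  q ∈ R ∪ B ∧ q ≠ x ∧ EquallyColored R B (radialInitial (R ∪ B) before x q) ∧
    ∀ p ∈ R ∪ B, p ≠ x → before x p q → ¬ EquallyColored R B (radialInitial (R ∪ B) before x p)

/-- The special configurations `(R ∪ B, r, b)`, for a red hull point `r` and a blue hull point
`b`. -/
structure IsSpecial (R B : Set Plane) (r b : Plane) : Prop where
  red_neighbors : ∀ p, HullNeighbors (R ∪ B) r p → p ∈ R
  blue_neighbors : ∀ p, HullNeighbors (R ∪ B) b p → p ∈ B
  ccw_around_red : IsFirstBalanced R B CcwBefore r b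
  cw_around_red : IsFirstBalanced R B CwBefore r b
  ccw_around_blue : IsFirstBalanced R B CcwBefore b r
  cw_around_blue : IsFirstBalanced R B CwBefore b r

/-- Two distinct straight-line edges cross if some point lies in the relative interior of both. -/
def EdgesCross (e f : Sym2 Plane) : Prop :=
  e ≠ f ∧ ∃ a b c d : Plane, e = s(a, b) ∧ f = s(c, d) ∧
    (openSegment ℝ a b ∩ openSegment ℝ c d).Nonempty

/-- A set of straight-line edges is 1-plane if every edge has at most one crossing. -/
def IsOnePlane (E : Set (Sym2 Plane)) : Prop :=
  ∀ e ∈ E, {f | f ∈ E ∧ EdgesCross e f}.encard ≤ 1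

/-- The number of crossings of a set of straight-line edges: the number of unordered pairs of
edges that cross. -/
noncomputable def numCrossings (E : Set (Sym2 Plane)) : ℕ :=
  {c : Sym2 (Sym2 Plane) | ∃ e ∈ E, ∃ f ∈ E, c = s(e, f) ∧ EdgesCross e f}.ncard

/-- The geometric graph of all bichromatic edges. -/
def bichromaticGraph (R B : Set Plane) : SimpleGraph Plane := (⊤ : SimpleGraph Plane).between R B

/-- The alternating walk `w` is a 1-plane Hamiltonian alternating path on `R ∪ B`: it repeats no
vertex, it visits exactly the points of `R ∪ B`, and its set of edges is 1-plane. -/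
structure IsOnePHAP {R B : Set Plane} {x y : Plane} (w : (bichromaticGraph R B).Walk x y) :
    Prop where
  isPath : w.IsPath
  hamiltonian : ∀ p, p ∈ w.support ↔ p ∈ R ∪ B
  onePlane : IsOnePlane {e | e ∈ w.edges}

/-! Both statements are proved together, by strong induction on the point set and for all colourings
with values 1 and -1: `EvenGoal` for balanced sets, `OddGoal` for sets with one excess point. The
number of runs is replaced by `tau`, the number of changes from -1 to 1 along the hull, which
depends neither on the sense of traversal nor on which colour is called red.

The engine is `Split`: a line through a point `x` cuts `S` into `P` and `Q` sharing only `x`. Paths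
of `P` and `Q` that end at `x` concatenate without new crossings, and `tau` is subadditive
(`Split.tau_le`), since a change on a hull edge of `S` across the line can be charged to a change on
the newly exposed part of a hull. As `|P| + |Q| = |S| + 1`, the crossing bounds add up exactly,
except when an odd set is cut into two balanced ones; then one more run is needed, and
`Split.tau_add_one_le` gains it from a monochromatic hull edge across the line.

Balanced sets: if the balance point of `r` in some sense is not `b`, cut at it or at the balance
point in the opposite sense; on the side of `r` the pivot is a hull neighbour of `r`, so that part
is non-special. The same applies to `b`. If all four balance points are `b` and `r`, the
configuration is special or `rb` is a hull edge. In the latter case delete `r` and `b`, take a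
bichromatic hull edge of the rest whose line separates it from `r` and `b`, and join `r` and `b` to
its ends (`even_of_hullEdge`). Only this step creates a crossing, at most one and between the two
new edges.

Odd sets: one side of the line `rr'` has at least as many red as blue points. If the hull neighbour
of `r` there is blue, the radial partial sums around `r` produce a red pivot
(`odd_of_blue_neighbor`). If it is red, the balanced radial set of `r` on the other side and the
remaining points have an inner common tangent, from which a pivot is chosen (`odd_of_red_neighbor`).
-/

namespace AlternatingPath

open scoped Classical

/-! ### Orientation, radial order around an extreme point, hull edges -/

/-- The linear functional with coefficients `a` and `b`. -/
def lin (a b : ℝ) (p : Plane) : ℝ := a * p 0 + b * p 1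

/-- No three points of `S` are collinear. -/
def GenPos (S : Finset Plane) : Prop :=
  ∀ p ∈ S, ∀ q ∈ S, ∀ t ∈ S, p ≠ q → q ≠ t → p ≠ t → orient p q t ≠ 0

/-- Some linear functional is maximal on `S` exactly at `p`. -/
def Extreme (S : Finset Plane) (p : Plane) : Prop :=
  ∃ a b, ∀ t ∈ S, t ≠ p → lin a b t < lin a b p

/-- `q` follows `p` on the convex hull of `S`, counterclockwise for `σ = 1`, clockwise for
`σ = -1`. -/
def HullEdge (σ : ℝ) (S : Finset Plane) (p q : Plane) : Prop :=
  p ∈ S ∧ q ∈ S ∧ p ≠ q ∧ ∀ t ∈ S, t ≠ p → t ≠ q → 0 < σ * orient p q t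

/-- The points of `S` up to `q` in the radial order of sense `σ` around `x`. -/
noncomputable def radialSet (σ : ℝ) (S : Finset Plane) (x q : Plane) : Finset Plane :=
  S.filter fun p => p = x ∨ p = q ∨ 0 < σ * orient x p q

/-- `σ` is one of the two senses of rotation. -/
def IsSense (σ : ℝ) : Prop := σ = 1 ∨ σ = -1

theorem IsSense.neg {σ : ℝ} (h : IsSense σ) : IsSense (-σ) := by
  rcases h with h | h <;> simp [IsSense, h]

theorem IsSense.ne_zero {σ : ℝ} (h : IsSense σ) : σ ≠ 0 := by
  rcases h with h | h <;> simp [h]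

theorem orient_swap (x p q : Plane) : orient x p q = -orient x q p := by
  unfold orient; ring

theorem orient_rotate (x p q : Plane) : orient x p q = orient p q x := by
  unfold orient; ring

theorem orient_flip (x p q : Plane) : orient x p q = -orient p x q := by
  unfold orient; ring

@[simp] theorem orient_self_left (x q : Plane) : orient x x q = 0 := by
  unfold orient; ring

@[simp] theorem orient_self_right (x q : Plane) : orient x q q = 0 := by
  unfold orient; ring

@[simp] theorem orient_self_mid (x q : Plane) : orient x q x = 0 := by
  unfold orient; ring

theorem plane_ext {p q : Plane} (h0 : p 0 = q 0) (h1 : p 1 = q 1) : p = q := by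
  ext i; fin_cases i <;> assumption

theorem GenPos.mono {S T : Finset Plane} (h : GenPos S) (hT : T ⊆ S) : GenPos T :=
  fun p hp q hq t ht => h p (hT hp) q (hT hq) t (hT ht)

theorem Extreme.mono {S T : Finset Plane} {p : Plane} (h : Extreme S p) (hT : T ⊆ S) :
    Extreme T p := by
  obtain ⟨a, b, h⟩ := h
  exact ⟨a, b, fun t ht => h t (hT ht)⟩

theorem HullEdge.mono {σ : ℝ} {S T : Finset Plane} {p q : Plane} (h : HullEdge σ S p q)
    (hT : T ⊆ S) (hp : p ∈ T) (hq : q ∈ T) : HullEdge σ T p q :=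
  ⟨hp, hq, h.2.2.1, fun t ht => h.2.2.2 t (hT ht)⟩

theorem HullEdge.symm {σ : ℝ} {S : Finset Plane} {p q : Plane} (h : HullEdge σ S p q) :
    HullEdge (-σ) S q p := by
  refine ⟨h.2.1, h.1, h.2.2.1.symm, fun t ht h1 h2 => ?_⟩
  have := h.2.2.2 t ht h2 h1
  rw [orient_flip q p t]; linarith

theorem hullEdge_neg {σ : ℝ} {S : Finset Plane} {p q : Plane} :
    HullEdge (-σ) S p q ↔ HullEdge σ S q p :=
  ⟨fun h => by simpa using h.symm, fun h => h.symm⟩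

theorem before_total {σ : ℝ} (hσ : IsSense σ) {x p q : Plane} (h : orient x p q ≠ 0) :
    0 < σ * orient x p q ∨ 0 < σ * orient x q p := by
  rw [orient_swap x q p]
  rcases lt_or_gt_of_ne (mul_ne_zero hσ.ne_zero h) with h | h
  · right; linarith
  · left; exact h

theorem before_asymm {σ : ℝ} {x p q : Plane} (h : 0 < σ * orient x p q) :
    ¬ 0 < σ * orient x q p := by
  rw [orient_swap x q p]; intro h'; linarith

theorem before_ne {σ : ℝ} {x p q : Plane} (h : 0 < σ * orient x p q) :
    p ≠ x ∧ q ≠ x ∧ p ≠ q := by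
  refine ⟨?_, ?_, ?_⟩ <;> rintro rfl <;> simp at h

/-- Extremality places all points in an open half-plane at `x`. The three orientations satisfy a
linear relation whose coefficients are the heights below `x`, all of them positive; without this
half-plane the radial relation would be cyclic. -/
theorem before_trans {σ : ℝ} {S : Finset Plane} {x p q t : Plane} (hx : Extreme S x)
    (hp : p ∈ S) (hq : q ∈ S) (ht : t ∈ S)
    (h1 : 0 < σ * orient x p q) (h2 : 0 < σ * orient x q t) : 0 < σ * orient x p t := by
  obtain ⟨a, b, h⟩ := hx
  have gp := h p hp (before_ne h1).1
  have gq := h q hq (before_ne h1).2.1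
  have gt := h t ht (before_ne h2).2.1
  have e : (lin a b x - lin a b q) * (σ * orient x p t) =
      (lin a b x - lin a b t) * (σ * orient x p q) +
      (lin a b x - lin a b p) * (σ * orient x q t) := by
    unfold lin orient; ring
  have : 0 < (lin a b x - lin a b q) * (σ * orient x p t) := by
    rw [e]
    have := mul_pos (sub_pos.2 gt) h1
    have := mul_pos (sub_pos.2 gp) h2
    linarith
  exact (pos_iff_pos_of_mul_pos this).1 (sub_pos.2 gq)

theorem exists_first {σ : ℝ} (hσ : IsSense σ) {S : Finset Plane} (hS : GenPos S) {x : Plane}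
    (hxS : x ∈ S) (hx : Extreme S x) (T : Finset Plane) (hT : T ⊆ S) (hxT : x ∉ T)
    (hne : T.Nonempty) : ∃ q ∈ T, ∀ t ∈ T, t ≠ q → 0 < σ * orient x q t := by
  induction T using Finset.induction_on with
  | empty => simp at hne
  | insert y T hy ih =>
    rcases T.eq_empty_or_nonempty with rfl | hT'
    · exact ⟨y, by simp, fun t ht h => absurd (by simpa using ht) h⟩
    · obtain ⟨q, hq, hmin⟩ := ih (fun z hz => hT (Finset.mem_insert_of_mem hz))
        (fun h => hxT (Finset.mem_insert_of_mem h)) hT'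
      have hyS := hT (Finset.mem_insert_self y T)
      have hqS := hT (Finset.mem_insert_of_mem hq)
      have hyx : y ≠ x := by rintro rfl; exact hxT (Finset.mem_insert_self _ _)
      have hqx : q ≠ x := by rintro rfl; exact hxT (Finset.mem_insert_of_mem hq)
      have hyq : y ≠ q := by rintro rfl; exact hy hq
      rcases before_total hσ (hS x hxS y hyS q hqS hyx.symm hyq hqx.symm) with h | h
      · refine ⟨y, Finset.mem_insert_self _ _, fun t ht hty => ?_⟩
        have htT := Finset.mem_of_mem_insert_of_ne ht hty
        by_cases htq : t = q
        · rwa [htq]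
        · exact before_trans hx hyS hqS (hT ht) h (hmin t htT htq)
      · refine ⟨q, Finset.mem_insert_of_mem hq, fun t ht htq => ?_⟩
        rcases Finset.mem_insert.1 ht with rfl | htT
        · exact h
        · exact hmin t htT htq

theorem exists_last {σ : ℝ} (hσ : IsSense σ) {S : Finset Plane} (hS : GenPos S) {x : Plane}
    (hxS : x ∈ S) (hx : Extreme S x) (T : Finset Plane) (hT : T ⊆ S) (hxT : x ∉ T)
    (hne : T.Nonempty) : ∃ q ∈ T, ∀ t ∈ T, t ≠ q → 0 < σ * orient x t q := by
  obtain ⟨q, hq, h⟩ := exists_first hσ.neg hS hxS hx T hT hxT hne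
  refine ⟨q, hq, fun t ht htq => ?_⟩
  have := h t ht htq
  rw [orient_swap]; linarith

theorem exists_hullEdge {σ : ℝ} (hσ : IsSense σ) {S : Finset Plane} (hS : GenPos S) {x : Plane}
    (hxS : x ∈ S) (hx : Extreme S x) (hne : ∃ y ∈ S, y ≠ x) : ∃ q, HullEdge σ S x q := by
  obtain ⟨y, hy, hyx⟩ := hne
  obtain ⟨q, hq, h⟩ := exists_first hσ hS hxS hx (S.erase x) (Finset.erase_subset _ _)
    (Finset.notMem_erase _ _) ⟨y, Finset.mem_erase.2 ⟨hyx, hy⟩⟩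
  rw [Finset.mem_erase] at hq
  exact ⟨q, hxS, hq.2, hq.1.symm, fun t ht h1 h2 => h t (Finset.mem_erase.2 ⟨h1, ht⟩) h2⟩

theorem HullEdge.unique {σ : ℝ} {S : Finset Plane} {x p q : Plane} (hp : HullEdge σ S x p)
    (hq : HullEdge σ S x q) : p = q := by
  by_contra hne
  have h1 := hp.2.2.2 q hq.2.1 hq.2.2.1.symm (Ne.symm hne)
  have h2 := hq.2.2.2 p hp.2.1 hp.2.2.1.symm hne
  exact before_asymm h1 h2

theorem HullEdge.unique_left {σ : ℝ} {S : Finset Plane} {x p q : Plane} (hp : HullEdge σ S p x)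
    (hq : HullEdge σ S q x) : p = q :=
  HullEdge.unique hp.symm hq.symm

/-- A small perturbation preserves finitely many strict inequalities. -/
theorem exists_small_perturbation {α : Type*} (T : Finset α) (f g : α → ℝ) (hf : ∀ t ∈ T, 0 < f t) :
    ∃ ε : ℝ, 0 < ε ∧ ∀ t ∈ T, 0 < f t + ε * g t := by
  induction T using Finset.induction_on with
  | empty => exact ⟨1, one_pos, by simp⟩
  | insert y T hy ih =>
    obtain ⟨ε, hε, h⟩ := ih fun t ht => hf t (Finset.mem_insert_of_mem ht)
    have hfy := hf y (Finset.mem_insert_self _ _)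
    have hd : 0 < |g y| + 1 := by positivity
    refine ⟨min ε (f y / (|g y| + 1)), lt_min hε (div_pos hfy hd), fun t ht => ?_⟩
    rcases Finset.mem_insert.1 ht with rfl | htT
    · have h1 : min ε (f t / (|g t| + 1)) * (|g t| + 1) ≤ f t :=
        (le_div_iff₀ hd).1 (min_le_right _ _)
      have h0 : 0 < min ε (f t / (|g t| + 1)) := lt_min hε (div_pos hfy hd)
      have h2 := mul_le_mul_of_nonneg_left (neg_abs_le (g t)) h0.le
      nlinarith
    · have h0 : 0 < min ε (f y / (|g y| + 1)) := lt_min hε (div_pos hfy hd)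
      have h1 := min_le_left ε (f y / (|g y| + 1))
      have h2 := h t htT
      have h3 := hf t (Finset.mem_insert_of_mem htT)
      rcases le_or_gt 0 (g t) with hg | hg
      · have := mul_nonneg h0.le hg; linarith
      · nlinarith

theorem HullEdge.extreme_left {σ : ℝ} {S : Finset Plane} {p q : Plane}
    (h : HullEdge σ S p q) : Extreme S p := by
  obtain ⟨hp, hq, hne, h⟩ := h
  -- The outward normal of the edge is maximal at both `p` and `q`; tilting it slightly from `q`
  -- towards `p` makes `p` the only maximum.
  obtain ⟨ε, hε, he⟩ := exists_small_perturbation ((S.erase p).erase q)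
    (fun t => σ * orient p q t)
    (fun t => (q 0 - p 0) * (t 0 - p 0) + (q 1 - p 1) * (t 1 - p 1)) (by
      intro t ht
      rw [Finset.mem_erase, Finset.mem_erase] at ht
      exact h t ht.2.2 ht.2.1 ht.1)
  have key : ∀ t, lin (σ * (q 1 - p 1) - ε * (q 0 - p 0)) (-σ * (q 0 - p 0) - ε * (q 1 - p 1)) p -
      lin (σ * (q 1 - p 1) - ε * (q 0 - p 0)) (-σ * (q 0 - p 0) - ε * (q 1 - p 1)) t =
      σ * orient p q t + ε * ((q 0 - p 0) * (t 0 - p 0) + (q 1 - p 1) * (t 1 - p 1)) := by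
    intro t; unfold lin orient; ring
  refine ⟨σ * (q 1 - p 1) - ε * (q 0 - p 0), -σ * (q 0 - p 0) - ε * (q 1 - p 1), fun t ht htp => ?_⟩
  rw [← sub_pos, key]
  by_cases htq : t = q
  · subst htq
    rw [orient_self_right, mul_zero, zero_add]
    apply mul_pos hε
    have : (t 0 - p 0) ≠ 0 ∨ (t 1 - p 1) ≠ 0 := by
      by_contra hcon
      push Not at hcon
      exact hne (plane_ext (by linarith [hcon.1]) (by linarith [hcon.2]))
    rcases this with h0 | h0
    · nlinarith [sq_pos_of_ne_zero h0, mul_self_nonneg (t 1 - p 1)]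
    · nlinarith [sq_pos_of_ne_zero h0, mul_self_nonneg (t 0 - p 0)]
  · exact he t (by simp [htq, htp, ht])

theorem HullEdge.extreme_right {σ : ℝ} {S : Finset Plane} {p q : Plane}
    (h : HullEdge σ S p q) : Extreme S q :=
  h.symm.extreme_left

/-- Three points at the same level of a nonzero functional are collinear. -/
theorem orient_eq_zero_of_lin_eq {a b : ℝ} (hab : a ≠ 0 ∨ b ≠ 0) {x y t : Plane}
    (h1 : lin a b x = lin a b y) (h2 : lin a b x = lin a b t) : orient x y t = 0 := by
  unfold lin at h1 h2
  have ea : a * orient x y t = 0 := by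
    unfold orient
    linear_combination (-(t 1 - x 1)) * h1 + (y 1 - x 1) * h2
  have eb : b * orient x y t = 0 := by
    unfold orient
    linear_combination ((t 0 - x 0)) * h1 - (y 0 - x 0) * h2
  rcases hab with h | h
  · exact (mul_eq_zero.1 ea).resolve_left h
  · exact (mul_eq_zero.1 eb).resolve_left h

theorem coeff_ne_zero_of_lin_lt {a b : ℝ} {x y : Plane} (h : lin a b x < lin a b y) :
    a ≠ 0 ∨ b ≠ 0 := by
  by_contra hcon
  push Not at hcon
  simp [lin, hcon.1, hcon.2] at h

/-! ### Colourings, radial partial sums, balance points -/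

/-- `χ` takes the value `1` on red and `-1` on blue points. -/
def IsColoring (χ : Plane → ℤ) : Prop := ∀ p, χ p = 1 ∨ χ p = -1

theorem IsColoring.neg {χ : Plane → ℤ} (h : IsColoring χ) : IsColoring (-χ) := by
  intro p
  rcases h p with h | h <;> simp [h]

/-- `q` is the first point around `x` at which the colours are balanced. -/
def FirstBalanced (σ : ℝ) (χ : Plane → ℤ) (S : Finset Plane) (x q : Plane) : Prop :=
  q ∈ S ∧ q ≠ x ∧ ∑ p ∈ radialSet σ S x q, χ p = 0 ∧
    ∀ p ∈ S, p ≠ x → 0 < σ * orient x p q → ∑ t ∈ radialSet σ S x p, χ t ≠ 0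

theorem mem_radialSet {σ : ℝ} {S : Finset Plane} {x q p : Plane} :
    p ∈ radialSet σ S x q ↔ p ∈ S ∧ (p = x ∨ p = q ∨ 0 < σ * orient x p q) := by
  simp [radialSet]

theorem radialSet_subset (σ : ℝ) (S : Finset Plane) (x q : Plane) : radialSet σ S x q ⊆ S :=
  Finset.filter_subset _ _

theorem notMem_radialSet {σ : ℝ} (hσ : IsSense σ) {S : Finset Plane} (hS : GenPos S)
    {x q p : Plane} (hx : x ∈ S) (hq : q ∈ S) (hqx : q ≠ x) (hp : p ∈ S) :
    p ∉ radialSet σ S x q ↔ 0 < σ * orient x q p := by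
  rw [mem_radialSet]
  constructor
  · intro h
    push Not at h
    obtain ⟨h1, h2, h3⟩ := h hp
    rcases before_total hσ (hS x hx p hp q hq (Ne.symm h1) h2 hqx.symm) with h | h
    · exact absurd h (not_lt.2 h3)
    · exact h
  · rintro h ⟨-, rfl | rfl | h'⟩
    · exact (before_ne h).2.1 rfl
    · simp at h
    · exact before_asymm h h'

theorem FirstBalanced.neg {σ : ℝ} {χ : Plane → ℤ} {S : Finset Plane} {x q : Plane}
    (h : FirstBalanced σ χ S x q) : FirstBalanced σ (-χ) S x q := by
  refine ⟨h.1, h.2.1, ?_, fun p hp hpx hb => ?_⟩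
  · simp [h.2.2.1]
  · have := h.2.2.2 p hp hpx hb
    simpa using this

theorem FirstBalanced.unique {σ : ℝ} (hσ : IsSense σ) {χ : Plane → ℤ} {S : Finset Plane}
    (hS : GenPos S) {x p q : Plane} (hx : x ∈ S)
    (hp : FirstBalanced σ χ S x p) (hq : FirstBalanced σ χ S x q) : p = q := by
  by_contra hne
  rcases before_total hσ (hS x hx p hp.1 q hq.1 hp.2.1.symm hne hq.2.1.symm) with h | h
  · exact hq.2.2.2 p hp.1 hp.2.1 h hp.2.2.1
  · exact hp.2.2.2 q hq.1 hq.2.1 h hq.2.2.1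

/-- Here `K` is an initial segment of the radial order and `z` its last element. -/
theorem sum_radialSet_last {σ : ℝ} {χ : Plane → ℤ} {S : Finset Plane} {x z : Plane}
    (hx : x ∈ S) {K : Finset Plane} (hK : K ⊆ S) (hxK : x ∉ K)
    (hdown : ∀ q ∈ K, ∀ p ∈ S, 0 < σ * orient x p q → p ∈ K) (hz : z ∈ K)
    (hlast : ∀ t ∈ K, t ≠ z → 0 < σ * orient x t z) :
    ∑ p ∈ radialSet σ S x z, χ p = χ x + ∑ p ∈ K, χ p := by
  rw [← Finset.sum_insert hxK]
  congr 1
  ext p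
  rw [mem_radialSet, Finset.mem_insert]
  constructor
  · rintro ⟨hp, rfl | rfl | h⟩
    · exact Or.inl rfl
    · exact Or.inr hz
    · exact Or.inr (hdown z hz p hp h)
  · rintro (rfl | hp)
    · exact ⟨hx, Or.inl rfl⟩
    · refine ⟨hK hp, Or.inr ?_⟩
      by_cases h : p = z
      · exact Or.inl h
      · exact Or.inr (hlast p hp h)

theorem sum_radialSet {σ : ℝ} {χ : Plane → ℤ} {S : Finset Plane} {x q : Plane}
    (hx : x ∈ S) (hq : q ∈ S) (hqx : q ≠ x) :
    ∑ p ∈ radialSet σ S x q, χ p =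
      χ q + (χ x + ∑ p ∈ S.filter (fun p => 0 < σ * orient x p q), χ p) := by
  have hxK : x ∉ S.filter (fun p => 0 < σ * orient x p q) := by simp
  have hqK : q ∉ insert x (S.filter (fun p => 0 < σ * orient x p q)) := by simp [hqx]
  rw [← Finset.sum_insert hxK, ← Finset.sum_insert hqK]
  congr 1
  ext p
  rw [mem_radialSet, Finset.mem_insert, Finset.mem_insert, Finset.mem_filter]
  constructor
  · rintro ⟨hp, h | h | h⟩ <;> tauto
  · rintro (rfl | rfl | h) <;> tauto

/-- A discrete intermediate value principle: just before the first `q` with partial sum at most `m`,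
the sum still exceeds `m`, unless no point precedes `q`. Since `K` is an initial segment, being
first in `K` is being first in `S`. -/
theorem exists_first_sum_le {σ : ℝ} (hσ : IsSense σ) {χ : Plane → ℤ} {S : Finset Plane}
    (hS : GenPos S) {x : Plane} (hx : x ∈ S) (hxe : Extreme S x) (m : ℤ) {K : Finset Plane}
    (hK : K ⊆ S) (hxK : x ∉ K)
    (hdown : ∀ q ∈ K, ∀ p ∈ S, 0 < σ * orient x p q → p ∈ K)
    (hex : ∃ q ∈ K, ∑ p ∈ radialSet σ S x q, χ p ≤ m) :
    ∃ q ∈ K, ∑ p ∈ radialSet σ S x q, χ p ≤ m ∧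
      (∀ p ∈ S, 0 < σ * orient x p q → m < ∑ t ∈ radialSet σ S x p, χ t) ∧
      (m < ∑ p ∈ radialSet σ S x q, χ p - χ q ∨
        (∑ p ∈ radialSet σ S x q, χ p = χ x + χ q ∧ ∀ p ∈ S, ¬ 0 < σ * orient x p q)) := by
  obtain ⟨q0, hq0, hm0⟩ := hex
  obtain ⟨q, hq, hfirst⟩ := exists_first hσ hS hx hxe
    (K.filter fun q => ∑ p ∈ radialSet σ S x q, χ p ≤ m)
    (fun t ht => hK (Finset.mem_of_mem_filter t ht))
    (fun h => hxK (Finset.mem_of_mem_filter x h)) ⟨q0, Finset.mem_filter.2 ⟨hq0, hm0⟩⟩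
  rw [Finset.mem_filter] at hq
  have hqx : q ≠ x := fun h => hxK (h ▸ hq.1)
  have hbef : ∀ p ∈ S, 0 < σ * orient x p q → m < ∑ t ∈ radialSet σ S x p, χ t := by
    intro p hp hb
    by_contra hcon
    have hpK := hdown q hq.1 p hp hb
    have := hfirst p (Finset.mem_filter.2 ⟨hpK, not_lt.1 hcon⟩) (before_ne hb).2.2
    exact before_asymm hb this
  refine ⟨q, hq.1, hq.2, hbef, ?_⟩
  set K' := S.filter (fun p => 0 < σ * orient x p q) with hK'
  have hsum := sum_radialSet (σ := σ) (χ := χ) hx (hK hq.1) hqx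
  rw [← hK'] at hsum
  rcases K'.eq_empty_or_nonempty with he | hne
  · right
    rw [he] at hsum
    refine ⟨by rw [hsum]; simp; ring, fun p hp hb => ?_⟩
    have : p ∈ K' := Finset.mem_filter.2 ⟨hp, hb⟩
    simp [he] at this
  · left
    have hxK' : x ∉ K' := by simp [hK']
    obtain ⟨z, hz, hlast⟩ := exists_last hσ hS hx hxe K' (Finset.filter_subset _ _) hxK' hne
    have hz' := Finset.mem_filter.1 hz
    have h1 := sum_radialSet_last (χ := χ) hx (Finset.filter_subset _ _) hxK' (by
      intro t ht p hp hb
      rw [Finset.mem_filter] at ht ⊢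
      exact ⟨hp, before_trans hxe hp ht.1 (hK hq.1) hb ht.2⟩) hz hlast
    have h2 := hbef z hz'.1 hz'.2
    rw [h1] at h2
    rw [hsum]
    linarith

/-- The partial sums start at `χ x = 1` and move by one, so the first value at most 0 equals 0 and
is reached by a step of -1. -/
theorem exists_firstBalanced {σ : ℝ} (hσ : IsSense σ) {χ : Plane → ℤ} (hχ : IsColoring χ)
    {S : Finset Plane} (hS : GenPos S) {x : Plane} (hx : x ∈ S) (hxe : Extreme S x)
    (hχx : χ x = 1) {K : Finset Plane} (hK : K ⊆ S) (hxK : x ∉ K)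
    (hdown : ∀ q ∈ K, ∀ p ∈ S, 0 < σ * orient x p q → p ∈ K)
    (hsum : 1 + ∑ p ∈ K, χ p ≤ 0) :
    ∃ q ∈ K, FirstBalanced σ χ S x q ∧ χ q = -1 := by
  have hne : K.Nonempty := by
    rw [Finset.nonempty_iff_ne_empty]
    rintro rfl
    simp at hsum
  obtain ⟨z, hz, hlast⟩ := exists_last hσ hS hx hxe K hK hxK hne
  obtain ⟨q, hq, h1, h2, h3⟩ := exists_first_sum_le hσ (χ := χ) hS hx hxe 0 hK hxK hdown
    ⟨z, hz, by rw [sum_radialSet_last (χ := χ) hx hK hxK hdown hz hlast, hχx]; exact hsum⟩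
  refine ⟨q, hq, ⟨hK hq, fun h => hxK (h ▸ hq), ?_, fun p hp _ hb => (h2 p hp hb).ne'⟩, ?_⟩ <;>
  · rcases hχ q with h | h <;> rcases h3 with h3 | ⟨h3, -⟩ <;> omega

theorem exists_firstBalanced_of_sum_eq_zero {σ : ℝ} (hσ : IsSense σ) {χ : Plane → ℤ}
    (hχ : IsColoring χ) {S : Finset Plane} (hS : GenPos S) {x : Plane} (hx : x ∈ S)
    (hxe : Extreme S x) (hχx : χ x = 1) (hsum : ∑ p ∈ S, χ p = 0) :
    ∃ q, FirstBalanced σ χ S x q ∧ χ q = -1 := by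
  have h := Finset.add_sum_erase S χ hx
  obtain ⟨q, -, hq⟩ := exists_firstBalanced hσ hχ hS hx hxe hχx (Finset.erase_subset x S)
    (Finset.notMem_erase x S) (fun q _ p hp hb => Finset.mem_erase.2 ⟨(before_ne hb).1, hp⟩)
    (by rw [← hχx, h, hsum])
  exact ⟨q, hq⟩

/-- The two closed sides of the line `xq` cover `S` and overlap in `x` and `q` only. This converts
balance in one sense into balance in the other. -/
theorem sum_radialSet_add_neg {σ : ℝ} (hσ : IsSense σ) {χ : Plane → ℤ} {S : Finset Plane}
    (hS : GenPos S) {x q : Plane} (hx : x ∈ S) (hq : q ∈ S) (hqx : q ≠ x) :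
    ∑ p ∈ radialSet σ S x q, χ p + ∑ p ∈ radialSet (-σ) S x q, χ p =
      ∑ p ∈ S, χ p + χ x + χ q := by
  have hu : radialSet σ S x q ∪ radialSet (-σ) S x q = S := by
    ext p
    rw [Finset.mem_union]
    constructor
    · rintro (h | h) <;> exact radialSet_subset _ _ _ _ h
    · intro hp
      by_contra hcon
      push Not at hcon
      have h1 := (notMem_radialSet hσ hS hx hq hqx hp).1 hcon.1
      have h2 := (notMem_radialSet hσ.neg hS hx hq hqx hp).1 hcon.2
      linarith
  have hi : radialSet σ S x q ∩ radialSet (-σ) S x q = {x, q} := by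
    ext p
    rw [Finset.mem_inter, mem_radialSet, mem_radialSet, Finset.mem_insert, Finset.mem_singleton]
    constructor
    · rintro ⟨⟨-, h | h | h⟩, -, h' | h' | h'⟩ <;> first | tauto | linarith
    · rintro (rfl | rfl) <;> tauto
  rw [← Finset.sum_union_inter, hu, hi, Finset.sum_pair hqx.symm]
  ring

/-! ### Colour changes along the hull -/

/-- The number of places on the convex hull of `S` where the colour changes from `-1` to `1`. -/
noncomputable def tau (σ : ℝ) (χ : Plane → ℤ) (S : Finset Plane) : ℕ :=
  ((S ×ˢ S).filter fun e => χ e.1 = -1 ∧ χ e.2 = 1 ∧ HullEdge σ S e.1 e.2).card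

theorem tau_neg_neg (σ : ℝ) (χ : Plane → ℤ) (S : Finset Plane) : tau (-σ) (-χ) S = tau σ χ S := by
  unfold tau
  refine Finset.card_bij (fun e _ => (e.2, e.1)) ?_ ?_ ?_
  · rintro ⟨p, q⟩ h
    simp only [Finset.mem_filter, Finset.mem_product, Pi.neg_apply, hullEdge_neg] at h ⊢
    exact ⟨h.1.symm, by omega, by omega, h.2.2.2⟩
  · rintro ⟨p, q⟩ _ ⟨p', q'⟩ _ h
    simp only [Prod.mk.injEq] at h ⊢
    exact h.symm
  · rintro ⟨p, q⟩ h
    refine ⟨(q, p), ?_, rfl⟩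
    simp only [Finset.mem_filter, Finset.mem_product, Pi.neg_apply, hullEdge_neg] at h ⊢
    exact ⟨h.1.symm, by omega, by omega, h.2.2.2⟩

/-- Every hull vertex starts exactly one hull edge; a singleton, whose vertex starts none, is
excluded by the condition on `y`. -/
theorem sum_hullEdge_fst {σ : ℝ} (hσ : IsSense σ) (χ : Plane → ℤ) {S : Finset Plane}
    (hS : GenPos S) :
    ∑ e ∈ (S ×ˢ S).filter (fun e => HullEdge σ S e.1 e.2), χ e.1 =
      ∑ p ∈ S.filter (fun p => Extreme S p ∧ ∃ y ∈ S, y ≠ p), χ p := by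
  refine Finset.sum_bij (fun e _ => e.1) ?_ ?_ ?_ (fun _ _ => rfl)
  · rintro ⟨p, q⟩ h
    simp only [Finset.mem_filter] at h ⊢
    exact ⟨h.2.1, h.2.extreme_left, q, h.2.2.1, h.2.2.2.1.symm⟩
  · rintro ⟨p, q⟩ h ⟨p', q'⟩ h' hpp
    simp only [Finset.mem_filter] at h h' hpp
    subst hpp
    rw [h.2.unique h'.2]
  · intro p h
    rw [Finset.mem_filter] at h
    obtain ⟨q, hq⟩ := exists_hullEdge hσ hS h.1 h.2.1 h.2.2
    exact ⟨(p, q), by simp [hq, hq.1, hq.2.1], rfl⟩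

theorem sum_hullEdge_snd {σ : ℝ} (hσ : IsSense σ) (χ : Plane → ℤ) {S : Finset Plane}
    (hS : GenPos S) :
    ∑ e ∈ (S ×ˢ S).filter (fun e => HullEdge σ S e.1 e.2), χ e.2 =
      ∑ p ∈ S.filter (fun p => Extreme S p ∧ ∃ y ∈ S, y ≠ p), χ p := by
  rw [← sum_hullEdge_fst hσ.neg χ hS]
  refine Finset.sum_bij (fun e _ => (e.2, e.1)) ?_ ?_ ?_ (fun _ _ => rfl)
  · rintro ⟨p, q⟩ h
    simp only [Finset.mem_filter, Finset.mem_product, hullEdge_neg] at h ⊢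
    exact ⟨h.1.symm, h.2⟩
  · rintro ⟨p, q⟩ _ ⟨p', q'⟩ _ h
    simp only [Prod.mk.injEq] at h ⊢
    exact h.symm
  · rintro ⟨p, q⟩ h
    simp only [Finset.mem_filter, Finset.mem_product, hullEdge_neg] at h
    exact ⟨(q, p), by simp [h.1, h.2], rfl⟩

/-- The hull is a closed cycle, so the differences of `χ` along its edges sum to 0, and each change
contributes 2 or -2 according to its direction. -/
theorem tau_neg_coloring {σ : ℝ} (hσ : IsSense σ) {χ : Plane → ℤ} (hχ : IsColoring χ)
    {S : Finset Plane} (hS : GenPos S) : tau σ (-χ) S = tau σ χ S := by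
  have h := (sum_hullEdge_snd hσ χ hS).trans (sum_hullEdge_fst hσ χ hS).symm
  have e1 : ∀ χ' : Plane → ℤ, (tau σ χ' S : ℤ) =
      ∑ e ∈ (S ×ˢ S).filter (fun e => HullEdge σ S e.1 e.2),
        if χ' e.1 = -1 ∧ χ' e.2 = 1 then 1 else 0 := by
    intro χ'
    rw [← Finset.sum_filter, Finset.filter_filter]
    unfold tau
    rw [Finset.card_eq_sum_ones]
    push_cast
    refine Finset.sum_congr ?_ fun _ _ => rfl
    ext e
    simp only [Finset.mem_filter]
    tauto
  have e2 : (2 : ℤ) * (tau σ χ S - tau σ (-χ) S) =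
      ∑ e ∈ (S ×ˢ S).filter (fun e => HullEdge σ S e.1 e.2), (χ e.2 - χ e.1) := by
    rw [e1, e1, ← Finset.sum_sub_distrib, Finset.mul_sum]
    refine Finset.sum_congr rfl fun e _ => ?_
    rcases hχ e.1 with h1 | h1 <;> rcases hχ e.2 with h2 | h2 <;> simp [h1, h2]
  rw [Finset.sum_sub_distrib, h, sub_self] at e2
  omega

theorem tau_sense {σ σ' : ℝ} (hσ : IsSense σ) (hσ' : IsSense σ') {χ : Plane → ℤ}
    (hχ : IsColoring χ) {S : Finset Plane} (hS : GenPos S) : tau σ χ S = tau σ' χ S := by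
  have key : ∀ s : ℝ, IsSense s → tau (-s) χ S = tau s χ S := fun s hs => by
    rw [← tau_neg_coloring hs.neg hχ hS, tau_neg_neg]
  rcases hσ with rfl | rfl <;> rcases hσ' with rfl | rfl
  · rfl
  · rw [key 1 (Or.inl rfl)]
  · rw [key 1 (Or.inl rfl)]
  · rfl

/-! ### Crossings and concatenation of separated paths -/

theorem lin_neg (a b : ℝ) (p : Plane) : lin (-a) (-b) p = -lin a b p := by
  unfold lin; ring

theorem lin_lt_of_mem_openSegment {a b c : ℝ} {p q z : Plane} (hz : z ∈ openSegment ℝ p q)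
    (hp : lin a b p ≤ c) (hq : lin a b q ≤ c) (h : lin a b p < c ∨ lin a b q < c) :
    lin a b z < c := by
  obtain ⟨s, t, hs, ht, hst, rfl⟩ := hz
  have e : lin a b (s • p + t • q) = s * lin a b p + t * lin a b q := by
    simp [lin]; ring
  rw [e]
  have hc : c = s * c + t * c := by rw [← add_mul, hst, one_mul]
  rcases h with h | h
  · have := mul_lt_mul_of_pos_left h hs
    have := mul_le_mul_of_nonneg_left hq ht.le
    linarith
  · have := mul_lt_mul_of_pos_left h ht
    have := mul_le_mul_of_nonneg_left hp hs.le
    linarith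

theorem le_lin_of_mem_openSegment {a b c : ℝ} {p q z : Plane} (hz : z ∈ openSegment ℝ p q)
    (hp : c ≤ lin a b p) (hq : c ≤ lin a b q) : c ≤ lin a b z := by
  obtain ⟨s, t, hs, ht, hst, rfl⟩ := hz
  have e : lin a b (s • p + t • q) = s * lin a b p + t * lin a b q := by
    simp [lin]; ring
  rw [e]
  have hc : c = s * c + t * c := by rw [← add_mul, hst, one_mul]
  have := mul_le_mul_of_nonneg_left hp hs.le
  have := mul_le_mul_of_nonneg_left hq ht.le
  linarith

theorem edgesCross_symm {e f : Sym2 Plane} (h : EdgesCross e f) : EdgesCross f e := by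
  obtain ⟨hne, a, b, c, d, he, hf, hn⟩ := h
  exact ⟨hne.symm, c, d, a, b, hf, he, by rwa [Set.inter_comm]⟩

/-- The edge `e` lies strictly below level `c` of a functional, up to its endpoints. -/
def EdgeBelow (a b c : ℝ) (e : Sym2 Plane) : Prop :=
  ∀ p q, e = s(p, q) → lin a b p ≤ c ∧ lin a b q ≤ c ∧ (lin a b p < c ∨ lin a b q < c)

/-- The edge `e` lies above level `c` of a functional. -/
def EdgeAbove (a b c : ℝ) (e : Sym2 Plane) : Prop :=
  ∀ p q, e = s(p, q) → c ≤ lin a b p ∧ c ≤ lin a b q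

theorem not_edgesCross_of_separated {a b c : ℝ} {e f : Sym2 Plane} (he : EdgeBelow a b c e)
    (hf : EdgeAbove a b c f) : ¬ EdgesCross e f := by
  rintro ⟨-, p, q, s, t, rfl, rfl, z, hz1, hz2⟩
  obtain ⟨h1, h2, h3⟩ := he p q rfl
  obtain ⟨h4, h5⟩ := hf s t rfl
  exact absurd (le_lin_of_mem_openSegment hz2 h4 h5)
    (not_le.2 (lin_lt_of_mem_openSegment hz1 h1 h2 h3))

theorem isOnePlane_union {E F : Set (Sym2 Plane)} (hE : IsOnePlane E) (hF : IsOnePlane F)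
    (hEF : ∀ e ∈ E, ∀ f ∈ F, ¬ EdgesCross e f) : IsOnePlane (E ∪ F) := by
  rintro e (he | he)
  · refine le_trans (Set.encard_le_encard ?_) (hE e he)
    rintro f ⟨hf | hf, hc⟩
    · exact ⟨hf, hc⟩
    · exact absurd hc (hEF e he f hf)
  · refine le_trans (Set.encard_le_encard ?_) (hF e he)
    rintro f ⟨hf | hf, hc⟩
    · exact absurd (edgesCross_symm hc) (hEF f hf e he)
    · exact ⟨hf, hc⟩

theorem numCrossings_union {E F : Set (Sym2 Plane)}
    (hEF : ∀ e ∈ E, ∀ f ∈ F, ¬ EdgesCross e f) :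
    numCrossings (E ∪ F) ≤ numCrossings E + numCrossings F := by
  unfold numCrossings
  refine le_trans (le_of_eq ?_) (Set.ncard_union_le _ _)
  congr 1
  ext c
  constructor
  · rintro ⟨e, he | he, f, hf | hf, hc, hx⟩
    · exact Or.inl ⟨e, he, f, hf, hc, hx⟩
    · exact absurd hx (hEF e he f hf)
    · exact absurd (edgesCross_symm hx) (hEF f hf e he)
    · exact Or.inr ⟨e, he, f, hf, hc, hx⟩
  · rintro (⟨e, he, f, hf, hc, hx⟩ | ⟨e, he, f, hf, hc, hx⟩)
    · exact ⟨e, Or.inl he, f, Or.inl hf, hc, hx⟩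
    · exact ⟨e, Or.inr he, f, Or.inr hf, hc, hx⟩

/-- A 1-plane Hamiltonian path in `G` on `S` from `x` to `y` with at most `k` crossings. -/
def HasPath (G : SimpleGraph Plane) (S : Finset Plane) (x y : Plane) (k : ℕ) : Prop :=
  ∃ w : G.Walk x y, w.IsPath ∧ (∀ p, p ∈ w.support ↔ p ∈ S) ∧ IsOnePlane {e | e ∈ w.edges} ∧
    numCrossings {e | e ∈ w.edges} ≤ k

theorem HasPath.reverse {G : SimpleGraph Plane} {S : Finset Plane} {x y : Plane} {k : ℕ}
    (h : HasPath G S x y k) : HasPath G S y x k := by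
  obtain ⟨w, h1, h2, h3, h4⟩ := h
  refine ⟨w.reverse, h1.reverse, fun p => ?_, ?_, ?_⟩
  · rw [← h2, SimpleGraph.Walk.support_reverse, List.mem_reverse]
  · simpa using h3
  · simpa using h4

/-- `P` and `Q` cover `S`, meet in `x` only, and are separated by a line through `x`. -/
structure Split (S P Q : Finset Plane) (x : Plane) : Prop where
  union : P ∪ Q = S
  mem_left : x ∈ P
  mem_right : x ∈ Q
  sep : ∃ a b c, lin a b x = c ∧ (∀ t ∈ P, t ≠ x → lin a b t < c) ∧ ∀ t ∈ Q, t ≠ x → c < lin a b t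

namespace Split

variable {S P Q : Finset Plane} {x : Plane}

theorem symm (h : Split S P Q x) : Split S Q P x := by
  obtain ⟨a, b, c, h1, h2, h3⟩ := h.sep
  refine ⟨by rw [Finset.union_comm, h.union], h.mem_right, h.mem_left, -a, -b, -c, ?_, ?_, ?_⟩
  · rw [lin_neg, h1]
  · intro t ht htx
    rw [lin_neg]; linarith [h3 t ht htx]
  · intro t ht htx
    rw [lin_neg]; linarith [h2 t ht htx]

theorem eq_of_mem (h : Split S P Q x) {p : Plane} (hp : p ∈ P) (hq : p ∈ Q) : p = x := by
  obtain ⟨a, b, c, h1, h2, h3⟩ := h.sep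
  by_contra hne
  exact absurd (h2 p hp hne) (not_lt.2 (h3 p hq hne).le)

theorem subset_left (h : Split S P Q x) : P ⊆ S := h.union ▸ Finset.subset_union_left

theorem subset_right (h : Split S P Q x) : Q ⊆ S := h.union ▸ Finset.subset_union_right

theorem inter (h : Split S P Q x) : P ∩ Q = {x} := by
  ext p
  rw [Finset.mem_inter, Finset.mem_singleton]
  constructor
  · rintro ⟨h1, h2⟩
    exact h.eq_of_mem h1 h2
  · rintro rfl
    exact ⟨h.mem_left, h.mem_right⟩

theorem card (h : Split S P Q x) : P.card + Q.card = S.card + 1 := by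
  rw [← Finset.card_union_add_card_inter, h.union, h.inter, Finset.card_singleton]

theorem sum (h : Split S P Q x) (χ : Plane → ℤ) :
    ∑ p ∈ P, χ p + ∑ p ∈ Q, χ p = ∑ p ∈ S, χ p + χ x := by
  rw [← Finset.sum_union_inter, h.union, h.inter, Finset.sum_singleton]

theorem extreme_left (h : Split S P Q x) : Extreme P x := by
  obtain ⟨a, b, c, h1, h2, -⟩ := h.sep
  exact ⟨a, b, fun t ht htx => by rw [h1]; exact h2 t ht htx⟩

theorem extreme_right (h : Split S P Q x) : Extreme Q x := h.symm.extreme_left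

/-- Edges on different sides of the line through `x` have disjoint interiors: an edge of `P` has at
most the end `x` on the line, so its interior is strictly below. -/
theorem hasPath (h : Split S P Q x) {G : SimpleGraph Plane} {u v : Plane} {k l : ℕ}
    (h1 : HasPath G P u x k) (h2 : HasPath G Q x v l) : HasPath G S u v (k + l) := by
  obtain ⟨w1, p1, s1, o1, c1⟩ := h1
  obtain ⟨w2, p2, s2, o2, c2⟩ := h2
  obtain ⟨a, b, c, hx, hP, hQ⟩ := h.sep
  have hE : {e | e ∈ (w1.append w2).edges} = {e | e ∈ w1.edges} ∪ {e | e ∈ w2.edges} := by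
    ext e; simp [SimpleGraph.Walk.edges_append]
  have hno : ∀ e ∈ {e | e ∈ w1.edges}, ∀ f ∈ {e | e ∈ w2.edges}, ¬ EdgesCross e f := by
    intro e he f hf
    have le1 : ∀ p ∈ P, lin a b p ≤ c := fun p hp => by
      by_cases hpx : p = x
      · rw [hpx, hx]
      · exact (hP p hp hpx).le
    have le2 : ∀ p ∈ Q, c ≤ lin a b p := fun p hp => by
      by_cases hpx : p = x
      · rw [hpx, hx]
      · exact (hQ p hp hpx).le
    refine not_edgesCross_of_separated (a := a) (b := b) (c := c) ?_ ?_
    · rintro p q rfl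
      have hp := (s1 p).1 (w1.fst_mem_support_of_mem_edges he)
      have hq := (s1 q).1 (w1.snd_mem_support_of_mem_edges he)
      have hne : p ≠ q := (w1.adj_of_mem_edges he).ne
      refine ⟨le1 p hp, le1 q hq, ?_⟩
      by_cases hpx : p = x
      · exact Or.inr (hP q hq fun hqx => hne (hpx.trans hqx.symm))
      · exact Or.inl (hP p hp hpx)
    · rintro p q rfl
      exact ⟨le2 p ((s2 p).1 (w2.fst_mem_support_of_mem_edges hf)),
        le2 q ((s2 q).1 (w2.snd_mem_support_of_mem_edges hf))⟩
  refine ⟨w1.append w2, ?_, fun p => ?_, ?_, ?_⟩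
  · rw [SimpleGraph.Walk.isPath_def, SimpleGraph.Walk.support_append, List.nodup_append]
    have hn2 := p2.support_nodup
    rw [← SimpleGraph.Walk.cons_tail_support, List.nodup_cons] at hn2
    refine ⟨p1.support_nodup, hn2.2, fun y hy z hz hyz => ?_⟩
    subst hyz
    have := h.eq_of_mem ((s1 y).1 hy) ((s2 y).1 (List.mem_of_mem_tail hz))
    subst this
    exact hn2.1 hz
  · rw [SimpleGraph.Walk.mem_support_append_iff, s1, s2, ← Finset.mem_union, h.union]
  · rw [hE]; exact isOnePlane_union o1 o2 hno
  · rw [hE]; exact (numCrossings_union hno).trans (add_le_add c1 c2)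

end Split

theorem isOnePlane_pair (e f : Sym2 Plane) : IsOnePlane {e, f} := by
  rintro g (rfl | rfl)
  · refine le_trans (Set.encard_le_encard (t := {f}) ?_) (Set.encard_singleton f).le
    rintro h ⟨rfl | rfl, hc⟩
    · exact absurd rfl hc.1
    · rfl
  · refine le_trans (Set.encard_le_encard (t := {e}) ?_) (Set.encard_singleton e).le
    rintro h ⟨rfl | rfl, hc⟩
    · rfl
    · exact absurd rfl hc.1

theorem numCrossings_pair (e f : Sym2 Plane) : numCrossings {e, f} ≤ 1 := by
  unfold numCrossings
  refine le_trans (Set.ncard_le_ncard (t := {s(e, f)}) ?_) (Set.ncard_singleton _).le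
  rintro c ⟨g, rfl | rfl, h, rfl | rfl, rfl, hc⟩
  · exact absurd rfl hc.1
  · rfl
  · exact Sym2.eq_swap
  · exact absurd rfl hc.1

/-- Extending a path at both ends by edges that lie on the other side of a line. -/
theorem HasPath.extend {G : SimpleGraph Plane} {T : Finset Plane} {u v x y : Plane} {k : ℕ}
    (h : HasPath G T x y k) (hux : G.Adj u x) (hyv : G.Adj y v) (huv : u ≠ v) {a b c : ℝ}
    (hu : lin a b u < c) (hv : lin a b v < c) (hx : lin a b x = c) (hy : lin a b y = c)
    (hT : ∀ t ∈ T, c ≤ lin a b t) : HasPath G (insert u (insert v T)) u v (1 + k) := by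
  obtain ⟨w, p, s, o, cr⟩ := h
  have hE : {e | e ∈ (SimpleGraph.Walk.cons hux (w.concat hyv)).edges} =
      {s(u, x), s(y, v)} ∪ {e | e ∈ w.edges} := by
    ext e
    simp only [SimpleGraph.Walk.edges_cons, SimpleGraph.Walk.edges_concat, List.mem_cons,
      Set.mem_ofPred_eq, Set.mem_union, Set.mem_insert_iff, Set.mem_singleton_iff,
      List.concat_eq_append, List.mem_append, List.not_mem_nil, or_false]
    tauto
  have hno : ∀ e ∈ ({s(u, x), s(y, v)} : Set (Sym2 Plane)), ∀ f ∈ {e | e ∈ w.edges},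
      ¬ EdgesCross e f := by
    intro e he f hf
    refine not_edgesCross_of_separated (a := a) (b := b) (c := c) ?_ ?_
    · intro p q hpq
      rcases he with rfl | rfl
      · rcases Sym2.eq_iff.1 hpq with ⟨rfl, rfl⟩ | ⟨rfl, rfl⟩
        · exact ⟨hu.le, hx.le, Or.inl hu⟩
        · exact ⟨hx.le, hu.le, Or.inr hu⟩
      · rcases Sym2.eq_iff.1 hpq with ⟨rfl, rfl⟩ | ⟨rfl, rfl⟩
        · exact ⟨hy.le, hv.le, Or.inr hv⟩
        · exact ⟨hv.le, hy.le, Or.inl hv⟩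
    · rintro p q rfl
      exact ⟨hT p ((s p).1 (w.fst_mem_support_of_mem_edges hf)),
        hT q ((s q).1 (w.snd_mem_support_of_mem_edges hf))⟩
  have huT : u ∉ T := fun h => absurd hu (not_lt.2 (hT u h))
  have hvT : v ∉ T := fun h => absurd hv (not_lt.2 (hT v h))
  refine ⟨SimpleGraph.Walk.cons hux (w.concat hyv), ?_, fun z => ?_, ?_, ?_⟩
  · rw [SimpleGraph.Walk.cons_isPath_iff, SimpleGraph.Walk.concat_isPath_iff,
      SimpleGraph.Walk.support_concat]
    refine ⟨⟨p, fun h => hvT ((s v).1 h)⟩, fun h => ?_⟩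
    simp only [List.mem_append, List.mem_singleton] at h
    rcases h with h | h
    · exact huT ((s u).1 h)
    · exact huv h
  · simp only [SimpleGraph.Walk.support_cons, SimpleGraph.Walk.support_concat,
      List.mem_append, List.mem_cons, List.not_mem_nil, or_false, Finset.mem_insert, s]
    tauto
  · rw [hE]; exact isOnePlane_union (isOnePlane_pair _ _) o hno
  · rw [hE]
    exact (numCrossings_union hno).trans (add_le_add (numCrossings_pair _ _) cr)

theorem hasPath_pair {G : SimpleGraph Plane} {x y : Plane} (h : G.Adj x y) :
    HasPath G {x, y} x y 0 := by
  have hE : {e | e ∈ (SimpleGraph.Walk.cons h .nil).edges} = {s(x, y)} := by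
    ext e; simp
  refine ⟨SimpleGraph.Walk.cons h .nil, ?_, fun p => by simp, ?_, ?_⟩
  · simp [SimpleGraph.Walk.cons_isPath_iff, h.ne]
  · rw [hE]
    have := isOnePlane_pair s(x, y) s(x, y)
    rwa [Set.pair_eq_singleton] at this
  · rw [hE]
    unfold numCrossings
    rw [Nat.le_zero, Set.ncard_eq_zero (Set.Finite.subset (Set.finite_singleton s(s(x, y), s(x, y)))
      (by rintro c ⟨e, rfl, f, rfl, rfl, -⟩; rfl))]
    ext c
    simp only [Set.mem_ofPred_eq, Set.mem_empty_iff_false, iff_false]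
    rintro ⟨e, rfl, f, rfl, -, hc⟩
    exact hc.1 rfl

/-! ### Ties between colours, and colour changes under splitting -/

/-- Interpolating between a function whose maximum is attained in `A` and one whose maximum is
attained in `B`, there is a first parameter at which the maximum is attained in both. -/
theorem exists_tie {α : Type*} {A B : Finset α} {f g : α → ℝ}
    (h0 : ∀ q ∈ B, ∃ p ∈ A, f q < f p) (h1 : ∃ q ∈ B, ∀ p ∈ A, g p < g q) :
    ∃ s : ℝ, 0 < s ∧ s < 1 ∧ ∃ p ∈ A, ∃ q ∈ B,
      (1 - s) * f p + s * g p = (1 - s) * f q + s * g q ∧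
      (∀ z ∈ A, (1 - s) * f z + s * g z ≤ (1 - s) * f p + s * g p) ∧
      (∀ z ∈ B, (1 - s) * f z + s * g z ≤ (1 - s) * f p + s * g p) ∧ f q < f p := by
  set F : ℝ → α → ℝ := fun s z => (1 - s) * f z + s * g z with hF
  have hcont : ∀ z, Continuous fun s => F s z := fun z => by simp only [hF]; fun_prop
  set T : Set ℝ := {s | ∃ q ∈ B, ∀ p ∈ A, F s p ≤ F s q} with hT
  have hclosed : IsClosed T := by
    have : T = ⋃ q ∈ B, ⋂ p ∈ A, {s | F s p ≤ F s q} := by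
      ext s; simp [hT]
    rw [this]
    refine isClosed_biUnion_finset fun q _ => isClosed_biInter fun p _ => ?_
    exact isClosed_le (hcont p) (hcont q)
  have hcomp : IsCompact (Set.Icc (0 : ℝ) 1 ∩ T) := isCompact_Icc.inter_right hclosed
  obtain ⟨q1, hq1, hq1'⟩ := h1
  have hne : (Set.Icc (0 : ℝ) 1 ∩ T).Nonempty := by
    refine ⟨1, by simp, q1, hq1, fun p hp => ?_⟩
    simp only [hF]
    have := hq1' p hp
    linarith
  obtain ⟨s, ⟨⟨hs0, hs1⟩, q0, hq0, hq0'⟩, hmin⟩ := hcomp.exists_isLeast hne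
  have hspos : 0 < s := by
    rcases hs0.lt_or_eq with h | h
    · exact h
    · exfalso
      subst h
      obtain ⟨p, hp, hlt⟩ := h0 q0 hq0
      have := hq0' p hp
      simp only [hF] at this
      linarith
  obtain ⟨q, hq, hqmax⟩ := B.exists_max_image (F s) ⟨q0, hq0⟩
  have hAle : ∀ p ∈ A, F s p ≤ F s q := fun p hp => (hq0' p hp).trans (hqmax q0 hq0)
  obtain ⟨ε, hε, he⟩ := exists_small_perturbation (A.filter fun p => F s p < F s q)
    (fun p => F s q - F s p) (fun p => f q - f p)
    (fun p hp => sub_pos.2 (Finset.mem_filter.1 hp).2)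
  have h1e : 0 < 1 + ε := by linarith
  -- Up to a positive factor, moving to the slightly smaller parameter `s / (1 + ε)` is adding `ε *
  -- f`. By minimality of `s` some `p` then beats `q`; for small `ε` such a `p` must tie with `q` at
  -- `s` and have the larger value of `f`.
  have hscale : ∀ z, (1 + ε) * F (s / (1 + ε)) z = F s z + ε * f z := by
    intro z
    simp only [hF]
    field_simp
    ring
  have hlt : s / (1 + ε) < s := div_lt_self hspos (by linarith)
  have hnot : s / (1 + ε) ∉ T := by
    intro h
    have := hmin ⟨⟨by positivity, by linarith⟩, h⟩
    linarith
  obtain ⟨p, hp, hpq⟩ : ∃ p ∈ A, F (s / (1 + ε)) q < F (s / (1 + ε)) p := by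
    by_contra hcon
    push Not at hcon
    exact hnot ⟨q, hq, hcon⟩
  have hpq' : F s q + ε * f q < F s p + ε * f p := by
    rw [← hscale, ← hscale]
    exact mul_lt_mul_of_pos_left hpq h1e
  have hge : F s q ≤ F s p := by
    by_contra hcon
    have := he p (Finset.mem_filter.2 ⟨hp, not_le.1 hcon⟩)
    linarith
  have heq : F s p = F s q := le_antisymm (hAle p hp) hge
  have hfp : f q < f p := by
    rw [heq] at hpq'
    exact lt_of_mul_lt_mul_left (by linarith) hε.le
  refine ⟨s, hspos, ?_, p, hp, q, hq, heq, fun z hz => ?_, fun z hz => ?_, hfp⟩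
  · refine lt_of_le_of_ne hs1 fun h => ?_
    subst h
    have h2 := hqmax q1 hq1
    rw [← heq] at h2
    have h3 := hq1' p hp
    simp only [hF] at h2
    linarith
  · exact (hAle z hz).trans heq.ge
  · exact (hqmax z hz).trans heq.ge

theorem lin_interpolate (a b a' b' s : ℝ) (z : Plane) :
    (1 - s) * lin a b z + s * lin a' b' z = lin ((1 - s) * a + s * a') ((1 - s) * b + s * b') z := by
  unfold lin; ring

/-- The orientation of a tie between two points, in terms of the sense of rotation of the
functional. -/
theorem orient_of_tie {σ a b a' b' s : ℝ} (hs : 0 < s) (hσ : 0 < σ * (a * b' - a' * b))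
    {p q t : Plane}
    (htie : (1 - s) * lin a b p + s * lin a' b' p = (1 - s) * lin a b q + s * lin a' b' q)
    (hpq : lin a b q < lin a b p) :
    ((1 - s) * lin a b t + s * lin a' b' t < (1 - s) * lin a b p + s * lin a' b' p →
      0 < σ * orient p q t) ∧
    ((1 - s) * lin a b p + s * lin a' b' p < (1 - s) * lin a b t + s * lin a' b' t →
      σ * orient p q t < 0) := by
  have key : (s * (a * b' - a' * b)) * orient p q t =
      (lin a b q - lin a b p) * (((1 - s) * lin a b t + s * lin a' b' t) -
        ((1 - s) * lin a b p + s * lin a' b' p)) := by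
    have : (s * (a * b' - a' * b)) * orient p q t =
      (lin a b q - lin a b p) * (((1 - s) * lin a b t + s * lin a' b' t) -
        ((1 - s) * lin a b p + s * lin a' b' p)) -
      (lin a b t - lin a b p) * (((1 - s) * lin a b q + s * lin a' b' q) -
        ((1 - s) * lin a b p + s * lin a' b' p)) := by
      unfold orient lin; ring
    rw [this, htie]; ring
  have hω : 0 < s * (σ * (a * b' - a' * b)) := mul_pos hs hσ
  have hne : σ ≠ 0 := by rintro rfl; simp at hσ
  have hσ2 : 0 < σ ^ 2 := by positivity
  have key2 : (s * (σ * (a * b' - a' * b))) * (σ * orient p q t) = σ ^ 2 *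
      ((lin a b q - lin a b p) * (((1 - s) * lin a b t + s * lin a' b' t) -
        ((1 - s) * lin a b p + s * lin a' b' p))) := by
    rw [← key]; ring
  constructor
  · intro h
    have h1 : 0 < (s * (σ * (a * b' - a' * b))) * (σ * orient p q t) := by
      rw [key2]
      exact mul_pos hσ2 (mul_pos_of_neg_of_neg (by linarith) (by linarith))
    exact (pos_iff_pos_of_mul_pos h1).1 hω
  · intro h
    by_contra hcon
    have h1 := mul_nonneg hω.le (not_lt.1 hcon)
    rw [key2] at h1
    have h2 := mul_neg_of_pos_of_neg hσ2 (mul_neg_of_neg_of_pos (sub_neg.2 hpq) (sub_pos.2 h))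
    linarith

/-- The points of `S` other than `p` and `q` do not reach the level of `p` and `q`. -/
theorem lt_of_le_of_tie {S : Finset Plane} (hS : GenPos S) {a b : ℝ} (hab : a ≠ 0 ∨ b ≠ 0)
    {p q t : Plane} (hp : p ∈ S) (hq : q ∈ S) (ht : t ∈ S) (hpq : p ≠ q) (hqt : q ≠ t)
    (hpt : p ≠ t) (he : lin a b p = lin a b q) (hle : lin a b t ≤ lin a b p) :
    lin a b t < lin a b p :=
  lt_of_le_of_ne hle fun h => hS p hp q hq t ht hpq hqt hpt (orient_eq_zero_of_lin_eq hab he h.symm)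

/-- If the two edges had no common end, each of four orientations would be positive; weighted by the
positive distances to the separating line, however, they sum to 0 identically. -/
theorem Split.bridge_unique {σ : ℝ} {S P Q : Finset Plane} {x : Plane} (h : Split S P Q x)
    {p q p' q' : Plane} (hpq : HullEdge σ S p q) (hpq' : HullEdge σ S p' q')
    (hp : p ∈ Q) (hpx : p ≠ x) (hq : q ∈ P) (hqx : q ≠ x)
    (hp' : p' ∈ Q) (hpx' : p' ≠ x) (hq' : q' ∈ P) (hqx' : q' ≠ x) : p = p' ∧ q = q' := by
  by_cases hpp : p = p'
  · subst hpp
    exact ⟨rfl, hpq.unique hpq'⟩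
  by_cases hqq : q = q'
  · subst hqq
    exact ⟨hpq.unique_left hpq', rfl⟩
  exfalso
  obtain ⟨a, b, c, -, h2, h3⟩ := h.sep
  have n1 : p ≠ q' := by rintro rfl; exact hpx (h.eq_of_mem hq' hp)
  have n2 : q ≠ p' := by rintro rfl; exact hqx (h.eq_of_mem hq hp')
  have o1 := hpq.2.2.2 p' hpq'.1 (Ne.symm hpp) n2.symm
  have o2 := hpq.2.2.2 q' hpq'.2.1 n1.symm (Ne.symm hqq)
  have o3 := hpq'.2.2.2 p hpq.1 hpp n1
  have o4 := hpq'.2.2.2 q hpq.2.1 n2 hqq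
  have u1 := sub_pos.2 (h3 p hp hpx)
  have u2 := sub_pos.2 (h2 q hq hqx)
  have u3 := sub_pos.2 (h3 p' hp' hpx')
  have u4 := sub_pos.2 (h2 q' hq' hqx')
  have m1 := mul_pos u4 o1
  have m2 := mul_pos u3 o2
  have m3 := mul_pos u2 o3
  have m4 := mul_pos u1 o4
  have key : (c - lin a b q') * (σ * orient p q p') + (lin a b p' - c) * (σ * orient p q q') +
      (c - lin a b q) * (σ * orient p' q' p) + (lin a b p - c) * (σ * orient p' q' q) = 0 := by
    unfold lin orient; ring
  linarith

/-- A hull edge of `S` that ends in `1` and crosses over from `Q` to `P` forces a colour change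
on the hull of `P` that is not a hull edge of `S`. -/
theorem Split.exists_change {σ : ℝ} (hσ : IsSense σ) {χ : Plane → ℤ} (hχ : IsColoring χ)
    {S P Q : Finset Plane} (hS : GenPos S) {x : Plane} (h : Split S P Q x) (hx : χ x = -1)
    {p q : Plane} (hpq : HullEdge σ S p q) (hp : p ∈ Q) (hpx : p ≠ x) (hq : q ∈ P) (hqx : q ≠ x)
    (hχq : χ q = 1) :
    ∃ p' q', χ p' = -1 ∧ χ q' = 1 ∧ HullEdge σ P p' q' ∧ ¬ HullEdge σ S p' q' := by
  obtain ⟨a, b, c, h1, h2, h3⟩ := h.sep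
  have hpP : p ∉ P := fun hpP => hpx (h.eq_of_mem hpP hp)
  have hlin1 : ∀ t, lin (σ * (q 1 - p 1)) (-σ * (q 0 - p 0)) t =
      lin (σ * (q 1 - p 1)) (-σ * (q 0 - p 0)) p - σ * orient p q t := by
    intro t; unfold lin orient; ring
  have hlq := hlin1 q
  rw [orient_self_right, mul_zero, sub_zero] at hlq
  -- Turn from the separating functional, whose maximum on `P` is the pivot `x` of colour -1, to the
  -- outward normal of `pq`, whose maximum on `P` is `q` of colour 1. At the first tie of the two
  -- colours the supporting line of `P` contains the desired change.
  obtain ⟨s, hs0, hs1, p', hp', q', hq', htie, hA, hB, hlt⟩ :=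
    exists_tie (A := P.filter fun z => χ z = -1) (B := P.filter fun z => χ z = 1)
      (f := lin a b) (g := lin (σ * (q 1 - p 1)) (-σ * (q 0 - p 0)))
      (fun z hz => ⟨x, by simp [hx, h.mem_left], by
        rw [Finset.mem_filter] at hz
        rw [h1]
        refine h2 z hz.1 ?_
        rintro rfl
        omega⟩)
      ⟨q, by simp [hq, hχq], fun z hz => by
        rw [Finset.mem_filter] at hz
        have hzp : z ≠ p := by rintro rfl; exact hpP hz.1
        have hzq : z ≠ q := by rintro rfl; omega
        rw [hlin1 z, hlq]
        linarith [hpq.2.2.2 z (h.subset_left hz.1) hzp hzq]⟩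
  rw [Finset.mem_filter] at hp' hq'
  have hmax : ∀ z ∈ P, (1 - s) * lin a b z + s * lin (σ * (q 1 - p 1)) (-σ * (q 0 - p 0)) z ≤
      (1 - s) * lin a b p' + s * lin (σ * (q 1 - p 1)) (-σ * (q 0 - p 0)) p' := by
    intro z hz
    rcases hχ z with hc | hc
    · exact hB z (by simp [hz, hc])
    · exact hA z (by simp [hz, hc])
  -- The point `p` of `Q` lies strictly beyond this supporting line, so the change found is not on
  -- the hull of `S`.
  have hple : (1 - s) * lin a b p' + s * lin (σ * (q 1 - p 1)) (-σ * (q 0 - p 0)) p' <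
      (1 - s) * lin a b p + s * lin (σ * (q 1 - p 1)) (-σ * (q 0 - p 0)) p := by
    have e1 : lin a b p' < lin a b p := by
      refine lt_of_le_of_lt ?_ (h3 p hp hpx)
      by_cases hp'x : p' = x
      · rw [hp'x, h1]
      · exact (h2 p' hp'.1 hp'x).le
    have e2 : lin (σ * (q 1 - p 1)) (-σ * (q 0 - p 0)) p' ≤
        lin (σ * (q 1 - p 1)) (-σ * (q 0 - p 0)) p := by
      by_cases hp'q : p' = q
      · rw [hp'q, hlq]
      · rw [hlin1 p']
        have := hpq.2.2.2 p' (h.subset_left hp'.1) (by rintro rfl; exact hpP hp'.1) hp'q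
        linarith
    have := mul_lt_mul_of_pos_left e1 (sub_pos.2 hs1)
    have := mul_le_mul_of_nonneg_left e2 hs0.le
    linarith
  have hrot : 0 < σ * (a * (-σ * (q 0 - p 0)) - σ * (q 1 - p 1) * b) := by
    have e : σ * (a * (-σ * (q 0 - p 0)) - σ * (q 1 - p 1) * b) =
        σ ^ 2 * (lin a b p - lin a b q) := by unfold lin; ring
    rw [e]
    have := h3 p hp hpx
    have := h2 q hq hqx
    have := hσ.ne_zero
    exact mul_pos (by positivity) (by linarith)
  have hne : p' ≠ q' := by rintro rfl; omega
  refine ⟨p', q', hp'.2, hq'.2, ⟨hp'.1, hq'.1, hne, fun t ht htp htq => ?_⟩, fun hcon => ?_⟩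
  · refine (orient_of_tie hs0 hrot htie hlt).1 ?_
    have hle := hmax t ht
    rw [lin_interpolate, lin_interpolate] at hple hle htie ⊢
    exact lt_of_le_of_tie hS (coeff_ne_zero_of_lin_lt hple) (h.subset_left hp'.1)
      (h.subset_left hq'.1) (h.subset_left ht) hne htq.symm htp.symm htie hle
  · have o1 := hcon.2.2.2 p hpq.1 (by rintro rfl; exact hpP hp'.1) (by rintro rfl; exact hpP hq'.1)
    have o2 := (orient_of_tie hs0 hrot htie hlt).2 hple
    linarith

/-- The colour changes from `-1` to `1` on the hull of `S`. -/
noncomputable def changes (σ : ℝ) (χ : Plane → ℤ) (S : Finset Plane) : Finset (Plane × Plane) :=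
  (S ×ˢ S).filter fun e => χ e.1 = -1 ∧ χ e.2 = 1 ∧ HullEdge σ S e.1 e.2

theorem card_changes (σ : ℝ) (χ : Plane → ℤ) (S : Finset Plane) :
    (changes σ χ S).card = tau σ χ S := rfl

theorem mem_changes {σ : ℝ} {χ : Plane → ℤ} {S : Finset Plane} {e : Plane × Plane} :
    e ∈ changes σ χ S ↔ χ e.1 = -1 ∧ χ e.2 = 1 ∧ HullEdge σ S e.1 e.2 := by
  simp only [changes, Finset.mem_filter, Finset.mem_product]
  exact ⟨fun h => h.2, fun h => ⟨⟨h.2.2.1, h.2.2.2.1⟩, h⟩⟩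

theorem Split.inner_subset {σ : ℝ} {χ : Plane → ℤ} {S P Q : Finset Plane} {x : Plane}
    (h : Split S P Q x) :
    (changes σ χ S).filter (fun e => e.1 ∈ P ∧ e.2 ∈ P) ⊆ changes σ χ P := by
  intro e he
  rw [Finset.mem_filter, mem_changes] at he
  exact mem_changes.2 ⟨he.1.1, he.1.2.1, he.1.2.2.mono h.subset_left he.2.1 he.2.2⟩

theorem Split.card_inner_add_one {σ : ℝ} (hσ : IsSense σ) {χ : Plane → ℤ} (hχ : IsColoring χ)
    {S P Q : Finset Plane} (hS : GenPos S) {x : Plane} (h : Split S P Q x) (hx : χ x = -1)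
    {p q : Plane} (hpq : HullEdge σ S p q) (hp : p ∈ Q) (hpx : p ≠ x) (hq : q ∈ P) (hqx : q ≠ x)
    (hχq : χ q = 1) :
    ((changes σ χ S).filter (fun e => e.1 ∈ P ∧ e.2 ∈ P)).card + 1 ≤ tau σ χ P := by
  obtain ⟨p', q', h1, h2, h3, h4⟩ := h.exists_change hσ hχ hS hx hpq hp hpx hq hqx hχq
  rw [← card_changes, ← Finset.card_insert_of_notMem (a := (p', q'))]
  · exact Finset.card_le_card (Finset.insert_subset (mem_changes.2 ⟨h1, h2, h3⟩) h.inner_subset)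
  · intro hcon
    rw [Finset.mem_filter, mem_changes] at hcon
    exact h4 hcon.1.2.2

/-- At most one hull edge leads from `Q` to `P`, and if it is a change, the new change on the hull
of `P` pays for it. -/
theorem Split.card_inner_add_bridge {σ : ℝ} (hσ : IsSense σ) {χ : Plane → ℤ} (hχ : IsColoring χ)
    {S P Q : Finset Plane} (hS : GenPos S) {x : Plane} (h : Split S P Q x) (hx : χ x = -1) :
    ((changes σ χ S).filter (fun e => e.1 ∈ P ∧ e.2 ∈ P)).card +
      ((changes σ χ S).filter (fun e => (e.1 ∈ Q ∧ e.1 ≠ x) ∧ e.2 ∈ P ∧ e.2 ≠ x)).card ≤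
      tau σ χ P := by
  rcases Finset.eq_empty_or_nonempty
    ((changes σ χ S).filter (fun e => (e.1 ∈ Q ∧ e.1 ≠ x) ∧ e.2 ∈ P ∧ e.2 ≠ x)) with he | ⟨e, he⟩
  · rw [he, Finset.card_empty, add_zero]
    exact Finset.card_le_card h.inner_subset
  · have hone : ((changes σ χ S).filter
        (fun e => (e.1 ∈ Q ∧ e.1 ≠ x) ∧ e.2 ∈ P ∧ e.2 ≠ x)).card ≤ 1 := by
      rw [Finset.card_le_one]
      rintro ⟨p, q⟩ h1 ⟨p', q'⟩ h2
      rw [Finset.mem_filter, mem_changes] at h1 h2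
      obtain ⟨rfl, rfl⟩ := h.bridge_unique h1.1.2.2 h2.1.2.2 h1.2.1.1 h1.2.1.2 h1.2.2.1 h1.2.2.2
        h2.2.1.1 h2.2.1.2 h2.2.2.1 h2.2.2.2
      rfl
    rw [Finset.mem_filter, mem_changes] at he
    have := h.card_inner_add_one hσ hχ hS hx he.1.2.2 he.2.1.1 he.2.1.2 he.2.2.1 he.2.2.2 he.1.2.1
    omega

theorem Split.changes_subset {σ : ℝ} {χ : Plane → ℤ}
    {S P Q : Finset Plane} {x : Plane} (h : Split S P Q x) :
    changes σ χ S ⊆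
      ((changes σ χ S).filter (fun e => e.1 ∈ P ∧ e.2 ∈ P) ∪
        (changes σ χ S).filter (fun e => (e.1 ∈ Q ∧ e.1 ≠ x) ∧ e.2 ∈ P ∧ e.2 ≠ x)) ∪
      ((changes σ χ S).filter (fun e => e.1 ∈ Q ∧ e.2 ∈ Q) ∪
        (changes σ χ S).filter (fun e => (e.1 ∈ P ∧ e.1 ≠ x) ∧ e.2 ∈ Q ∧ e.2 ≠ x)) := by
  rintro ⟨p, q⟩ he
  have he' := mem_changes.1 he
  have hxP := h.mem_left
  have hxQ := h.mem_right
  have hp : p ∈ P ∨ p ∈ Q := by rw [← Finset.mem_union, h.union]; exact he'.2.2.1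
  have hq : q ∈ P ∨ q ∈ Q := by rw [← Finset.mem_union, h.union]; exact he'.2.2.2.1
  simp only [Finset.mem_union, Finset.mem_filter, he, true_and]
  by_cases hpx : p = x
  · subst hpx; tauto
  · by_cases hqx : q = x
    · subst hqx; tauto
    · tauto

/-- Every change of `S` lies within `P`, lies within `Q`, or bridges in one of the two directions;
edges at `x` count as lying within a part. Each part pays for the bridge that ends in it. -/
theorem Split.tau_le_of_pivot {σ : ℝ} (hσ : IsSense σ) {χ : Plane → ℤ} (hχ : IsColoring χ)
    {S P Q : Finset Plane} (hS : GenPos S) {x : Plane} (h : Split S P Q x) (hx : χ x = -1) :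
    tau σ χ S ≤ tau σ χ P + tau σ χ Q := by
  have h1 := h.card_inner_add_bridge hσ hχ hS hx
  have h2 := h.symm.card_inner_add_bridge hσ hχ hS hx
  have h3 := Finset.card_le_card (h.changes_subset (σ := σ) (χ := χ))
  rw [card_changes] at h3
  have h4 := h3.trans ((Finset.card_union_le _ _).trans
    (add_le_add (Finset.card_union_le _ _) (Finset.card_union_le _ _)))
  omega

theorem Split.tau_le {σ : ℝ} (hσ : IsSense σ) {χ : Plane → ℤ} (hχ : IsColoring χ)
    {S P Q : Finset Plane} (hS : GenPos S) {x : Plane} (h : Split S P Q x) :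
    tau σ χ S ≤ tau σ χ P + tau σ χ Q := by
  rcases hχ x with hx | hx
  · have := h.tau_le_of_pivot hσ hχ.neg hS (by simp [hx])
    rwa [tau_neg_coloring hσ hχ hS, tau_neg_coloring hσ hχ (hS.mono h.subset_left),
      tau_neg_coloring hσ hχ (hS.mono h.subset_right)] at this
  · exact h.tau_le_of_pivot hσ hχ hS hx

/-- If a hull edge joins points of colour `1` across a split at a point of colour `-1`, then
splitting creates an additional run. -/
theorem Split.tau_add_one_le {σ : ℝ} (hσ : IsSense σ) {χ : Plane → ℤ} (hχ : IsColoring χ)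
    {S P Q : Finset Plane} (hS : GenPos S) {x : Plane} (h : Split S P Q x) (hx : χ x = -1)
    {p q : Plane} (hpq : HullEdge σ S p q) (hp : p ∈ Q) (hpx : p ≠ x) (hq : q ∈ P) (hqx : q ≠ x)
    (hχp : χ p = 1) (hχq : χ q = 1) :
    tau σ χ S + 1 ≤ tau σ χ P + tau σ χ Q := by
  have h1 := h.card_inner_add_one hσ hχ hS hx hpq hp hpx hq hqx hχq
  have h2 := h.symm.card_inner_add_bridge hσ hχ hS hx
  have h3 := Finset.card_le_card (h.changes_subset (σ := σ) (χ := χ))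
  rw [card_changes] at h3
  have h4 := h3.trans ((Finset.card_union_le _ _).trans
    (add_le_add (Finset.card_union_le _ _) (Finset.card_union_le _ _)))
  have h5 : (changes σ χ S).filter (fun e => (e.1 ∈ Q ∧ e.1 ≠ x) ∧ e.2 ∈ P ∧ e.2 ≠ x) = ∅ := by
    rw [Finset.filter_eq_empty_iff]
    rintro ⟨p', q'⟩ he ⟨⟨a1, a2⟩, a3, a4⟩
    rw [mem_changes] at he
    obtain ⟨rfl, rfl⟩ := h.bridge_unique hpq he.2.2 hp hpx hq hqx a1 a2 a3 a4
    simp only at he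
    omega
  rw [h5, Finset.card_empty, add_zero] at h4
  omega

/-! ### Splits obtained by rotating a line through two points -/

/-- A line through `x` and `y` with `A` below and `Z` above can be rotated about `x` so that `y`
falls below. -/
theorem split_of_tie {S A Z : Finset Plane} {x y : Plane} (hxy : x ≠ y) {a b c : ℝ}
    (hab : a ≠ 0 ∨ b ≠ 0) (hx : lin a b x = c) (hy : lin a b y = c)
    (hA : ∀ t ∈ A, lin a b t < c) (hZ : ∀ t ∈ Z, c < lin a b t)
    (hu : insert x (insert y (A ∪ Z)) = S) :
    Split S (insert x (insert y A)) (insert x Z) x := by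
  have hv : 0 < (x 0 - y 0) ^ 2 + (x 1 - y 1) ^ 2 := by
    by_contra hcon
    have h0 := sq_nonneg (x 0 - y 0)
    have h1 := sq_nonneg (x 1 - y 1)
    have e0 : (x 0 - y 0) ^ 2 = 0 := by linarith
    have e1 : (x 1 - y 1) ^ 2 = 0 := by linarith
    exact hxy (plane_ext (sub_eq_zero.1 (pow_eq_zero_iff two_ne_zero |>.1 e0))
      (sub_eq_zero.1 (pow_eq_zero_iff two_ne_zero |>.1 e1)))
  -- Adding a small multiple of the direction from `y` to `x` pushes `y` below `x`; `ε` is small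
  -- enough to keep every other point on its side.
  obtain ⟨ε, hε, he⟩ := exists_small_perturbation (A ∪ Z) (fun t => |lin a b t - c|)
    (fun t => -|lin (x 0 - y 0) (x 1 - y 1) t - lin (x 0 - y 0) (x 1 - y 1) x|) (by
      intro t ht
      rw [abs_pos, sub_ne_zero]
      rcases Finset.mem_union.1 ht with h | h
      · exact (hA t h).ne
      · exact (hZ t h).ne')
  have hlin : ∀ t, lin (a + ε * (x 0 - y 0)) (b + ε * (x 1 - y 1)) t =
      lin a b t + ε * lin (x 0 - y 0) (x 1 - y 1) t := by
    intro t; unfold lin; ring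
  refine ⟨?_, by simp, by simp, a + ε * (x 0 - y 0), b + ε * (x 1 - y 1),
    c + ε * lin (x 0 - y 0) (x 1 - y 1) x, by rw [hlin, hx], ?_, ?_⟩
  · rw [← hu]; ext t; simp only [Finset.mem_union, Finset.mem_insert]; tauto
  · intro t ht htx
    rw [hlin]
    rcases Finset.mem_insert.1 ht with h | ht
    · exact absurd h htx
    rcases Finset.mem_insert.1 ht with rfl | ht
    · rw [hy]
      have : lin (x 0 - t 0) (x 1 - t 1) t < lin (x 0 - t 0) (x 1 - t 1) x := by
        unfold lin; nlinarith
      nlinarith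
    · have h1 := he t (Finset.mem_union_left _ ht)
      have h2 := hA t ht
      rw [abs_of_neg (sub_neg.2 h2)] at h1
      have h3 := mul_le_mul_of_nonneg_left
        (le_abs_self (lin (x 0 - y 0) (x 1 - y 1) t - lin (x 0 - y 0) (x 1 - y 1) x)) hε.le
      linarith
  · intro t ht htx
    rw [hlin]
    rcases Finset.mem_insert.1 ht with h | ht
    · exact absurd h htx
    have h1 := he t (Finset.mem_union_right _ ht)
    have h2 := hZ t ht
    rw [abs_of_pos (sub_pos.2 h2)] at h1
    have h3 := mul_le_mul_of_nonneg_left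
      (neg_abs_le (lin (x 0 - y 0) (x 1 - y 1) t - lin (x 0 - y 0) (x 1 - y 1) x)) hε.le
    linarith

/-- A line through `x` and `y` with `A` below and `Z` above can be rotated about `x` so that `y`
falls above. -/
theorem split_of_tie' {S A Z : Finset Plane} {x y : Plane} (hxy : x ≠ y) {a b c : ℝ}
    (hab : a ≠ 0 ∨ b ≠ 0) (hx : lin a b x = c) (hy : lin a b y = c)
    (hA : ∀ t ∈ A, lin a b t < c) (hZ : ∀ t ∈ Z, c < lin a b t)
    (hu : insert x (insert y (A ∪ Z)) = S) :
    Split S (insert x A) (insert x (insert y Z)) x := by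
  refine (split_of_tie (a := -a) (b := -b) (c := -c) hxy (by simpa using hab)
    (by rw [lin_neg, hx]) (by rw [lin_neg, hy]) (fun t ht => ?_) (fun t ht => ?_) ?_).symm
  · rw [lin_neg]; linarith [hZ t ht]
  · rw [lin_neg]; linarith [hA t ht]
  · rw [Finset.union_comm, hu]

/-! ### The induction statements and their combination along a split -/

/-- The special configurations, in terms of `HullEdge` and `FirstBalanced`. -/
structure Special (χ : Plane → ℤ) (S : Finset Plane) (r b : Plane) : Prop where
  red_neighbors : ∀ σ, IsSense σ → ∀ q, HullEdge σ S r q → χ q = 1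
  blue_neighbors : ∀ σ, IsSense σ → ∀ q, HullEdge σ S b q → χ q = -1
  around_red : ∀ σ, IsSense σ → FirstBalanced σ χ S r b
  around_blue : ∀ σ, IsSense σ → FirstBalanced σ χ S b r

/-- A two-coloured set in general position whose bichromatic pairs are edges of `G`. -/
structure Config (G : SimpleGraph Plane) (χ : Plane → ℤ) (S : Finset Plane) : Prop where
  color : IsColoring χ
  gen : GenPos S
  adj : ∀ p ∈ S, ∀ q ∈ S, χ p ≠ χ q → G.Adj p q

theorem Config.mono {G : SimpleGraph Plane} {χ : Plane → ℤ} {S T : Finset Plane}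
    (h : Config G χ S) (hT : T ⊆ S) : Config G χ T :=
  ⟨h.color, h.gen.mono hT, fun p hp q hq => h.adj p (hT hp) q (hT hq)⟩

theorem Config.neg {G : SimpleGraph Plane} {χ : Plane → ℤ} {S : Finset Plane}
    (h : Config G χ S) : Config G (-χ) S :=
  ⟨h.color.neg, h.gen, fun p hp q hq hne => h.adj p hp q hq fun he => hne (by simp [he])⟩

/-- Balanced sets: paths between a red and a blue hull point. -/
def EvenGoal (G : SimpleGraph Plane) (S : Finset Plane) : Prop :=
  ∀ χ, Config G χ S → ∑ p ∈ S, χ p = 0 → ∀ r ∈ S, ∀ b ∈ S, χ r = 1 → χ b = -1 →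
    Extreme S r → Extreme S b → ¬ Special χ S r b →
    ∃ k, HasPath G S r b k ∧ 2 * (k + tau 1 χ S) ≤ S.card

/-- Sets with one excess red point: paths between two red hull points. -/
def OddGoal (G : SimpleGraph Plane) (S : Finset Plane) : Prop :=
  ∀ χ, Config G χ S → ∑ p ∈ S, χ p = 1 → ∀ r ∈ S, ∀ r' ∈ S, r ≠ r' → χ r = 1 → χ r' = 1 →
    Extreme S r → Extreme S r' →
    ∃ k, HasPath G S r r' k ∧ 2 * (k + tau 1 χ S) + 1 ≤ S.card

theorem isSense_one : IsSense 1 := Or.inl rfl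

theorem not_special_of_hullEdge {σ : ℝ} (hσ : IsSense σ) {χ : Plane → ℤ} {S : Finset Plane}
    {r b : Plane} (h : HullEdge σ S r b) (hb : χ b = -1) : ¬ Special χ S r b := by
  intro hs
  have := hs.red_neighbors σ hσ b h
  omega

theorem OddGoal.blue {G : SimpleGraph Plane} {S : Finset Plane} (h : OddGoal G S)
    {χ : Plane → ℤ} (hc : Config G χ S) (hsum : ∑ p ∈ S, χ p = -1) {b b' : Plane} (hb : b ∈ S)
    (hb' : b' ∈ S) (hne : b ≠ b') (hχ : χ b = -1) (hχ' : χ b' = -1) (he : Extreme S b)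
    (he' : Extreme S b') : ∃ k, HasPath G S b b' k ∧ 2 * (k + tau 1 χ S) + 1 ≤ S.card := by
  have := h (-χ) hc.neg (by simp [hsum]) b hb b' hb' hne (by simp [hχ]) (by simp [hχ']) he he'
  rwa [tau_neg_coloring isSense_one hc.color hc.gen] at this

theorem Split.ssubset_left {S P Q : Finset Plane} {x v : Plane} (h : Split S P Q x) (hv : v ∈ Q)
    (hvx : v ≠ x) : P ⊂ S :=
  (Finset.ssubset_iff_of_subset h.subset_left).2
    ⟨v, h.subset_right hv, fun hP => hvx (h.eq_of_mem hP hv)⟩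

section Combine

variable {G : SimpleGraph Plane} {S P Q : Finset Plane} {x : Plane} {χ : Plane → ℤ}

/-- The part `P` is balanced and `Q` has one excess point of the colour of the pivot. The `+ 1` in
the odd bound for `Q` cancels the double count of `x`. -/
theorem even_of_split (hE : ∀ T ⊂ S, EvenGoal G T) (hO : ∀ T ⊂ S, OddGoal G T)
    (hc : Config G χ S) (hsum : ∑ p ∈ S, χ p = 0) (h : Split S P Q x) (hx : χ x = -1)
    (hP : ∑ p ∈ P, χ p = 0) {r b : Plane} (hr : r ∈ P) (hχr : χ r = 1) (hb : b ∈ Q) (hbx : b ≠ x)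
    (hχb : χ b = -1) (hre : Extreme S r) (hbe : Extreme S b) (hns : ¬ Special χ P r x) :
    ∃ k, HasPath G S r b k ∧ 2 * (k + tau 1 χ S) ≤ S.card := by
  have hrx : r ≠ x := by rintro rfl; omega
  obtain ⟨k, hk, hk'⟩ := hE P (h.ssubset_left hb hbx) χ (hc.mono h.subset_left) hP r hr x
    h.mem_left hχr hx (hre.mono h.subset_left) h.extreme_left hns
  have hs := h.sum χ
  obtain ⟨l, hl, hl'⟩ := (hO Q (h.symm.ssubset_left hr hrx)).blue (hc.mono h.subset_right)
    (by omega) h.mem_right hb hbx.symm hx hχb h.extreme_right (hbe.mono h.subset_right)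
  refine ⟨k + l, h.hasPath hk hl, ?_⟩
  have := h.tau_le isSense_one hc.color hc.gen
  have := h.card
  omega

/-- Both parts are odd; their two extra units leave one after the double count of the pivot. -/
theorem odd_of_split_red (hO : ∀ T ⊂ S, OddGoal G T)
    (hc : Config G χ S) (hsum : ∑ p ∈ S, χ p = 1) (h : Split S P Q x) (hx : χ x = 1)
    (hP : ∑ p ∈ P, χ p = 1) {r r' : Plane} (hr : r ∈ P) (hrx : r ≠ x) (hχr : χ r = 1)
    (hr' : r' ∈ Q) (hrx' : r' ≠ x) (hχr' : χ r' = 1) (hre : Extreme S r) (hre' : Extreme S r') :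
    ∃ k, HasPath G S r r' k ∧ 2 * (k + tau 1 χ S) + 1 ≤ S.card := by
  obtain ⟨k, hk, hk'⟩ := hO P (h.ssubset_left hr' hrx') χ (hc.mono h.subset_left) hP r hr x
    h.mem_left hrx hχr hx (hre.mono h.subset_left) h.extreme_left
  have hs := h.sum χ
  obtain ⟨l, hl, hl'⟩ := hO Q (h.symm.ssubset_left hr hrx) χ (hc.mono h.subset_right)
    (by omega) x h.mem_right r' hr' hrx'.symm hx hχr' h.extreme_right (hre'.mono h.subset_right)
  refine ⟨k + l, h.hasPath hk hl, ?_⟩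
  have := h.tau_le isSense_one hc.color hc.gen
  have := h.card
  omega

/-- Both parts are balanced, so subadditivity of `tau` alone would leave the bound off by one. The
red hull edge `zr` across the line forces an additional run in the parts, which closes the gap. -/
theorem odd_of_split_blue (hE : ∀ T ⊂ S, EvenGoal G T)
    (hc : Config G χ S) (hsum : ∑ p ∈ S, χ p = 1) (h : Split S P Q x) (hx : χ x = -1)
    (hP : ∑ p ∈ P, χ p = 0) {r r' : Plane} (hr : r ∈ P) (hχr : χ r = 1)
    (hr' : r' ∈ Q) (hχr' : χ r' = 1) (hre : Extreme S r) (hre' : Extreme S r')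
    {σ : ℝ} (hσ : IsSense σ) {z : Plane} (hz : HullEdge σ S z r) (hzQ : z ∈ Q) (hχz : χ z = 1)
    (hns : ¬ Special χ P r x) (hns' : ¬ Special χ Q r' x) :
    ∃ k, HasPath G S r r' k ∧ 2 * (k + tau 1 χ S) + 1 ≤ S.card := by
  have hrx : r ≠ x := by rintro rfl; omega
  have hrx' : r' ≠ x := by rintro rfl; omega
  have hzx : z ≠ x := by rintro rfl; omega
  obtain ⟨k, hk, hk'⟩ := hE P (h.ssubset_left hr' hrx') χ (hc.mono h.subset_left) hP r hr x
    h.mem_left hχr hx (hre.mono h.subset_left) h.extreme_left hns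
  have hs := h.sum χ
  obtain ⟨l, hl, hl'⟩ := hE Q (h.symm.ssubset_left hr hrx) χ (hc.mono h.subset_right)
    (by omega) r' hr' x h.mem_right hχr' hx (hre'.mono h.subset_right) h.extreme_right hns'
  refine ⟨k + l, h.hasPath hk hl.reverse, ?_⟩
  have h1 := h.tau_add_one_le hσ hc.color hc.gen hx hz hzQ hzx hr hrx hχz hχr
  rw [tau_sense hσ isSense_one hc.color hc.gen,
    tau_sense hσ isSense_one hc.color (hc.gen.mono h.subset_left),
    tau_sense hσ isSense_one hc.color (hc.gen.mono h.subset_right)] at h1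
  have := h.card
  omega

end Combine

/-! ### Splitting along the radial order -/

theorem lin_radial (σ : ℝ) (x q t : Plane) :
    lin (-σ * (q 1 - x 1)) (σ * (q 0 - x 0)) t =
      lin (-σ * (q 1 - x 1)) (σ * (q 0 - x 0)) x + σ * orient x q t := by
  unfold lin orient; ring

theorem coeff_radial_ne_zero {σ : ℝ} (hσ : IsSense σ) {x q : Plane} (hqx : q ≠ x) :
    -σ * (q 1 - x 1) ≠ 0 ∨ σ * (q 0 - x 0) ≠ 0 := by
  by_contra hcon
  push Not at hcon
  have h1 := (mul_eq_zero.1 hcon.1).resolve_left (neg_ne_zero.2 hσ.ne_zero)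
  have h0 := (mul_eq_zero.1 hcon.2).resolve_left hσ.ne_zero
  exact hqx (plane_ext (sub_eq_zero.1 h0) (sub_eq_zero.1 h1))

theorem left_mem_radialSet {σ : ℝ} {S : Finset Plane} {x q : Plane} (hx : x ∈ S) :
    x ∈ radialSet σ S x q := mem_radialSet.2 ⟨hx, Or.inl rfl⟩

theorem right_mem_radialSet {σ : ℝ} {S : Finset Plane} {x q : Plane} (hq : q ∈ S) :
    q ∈ radialSet σ S x q := mem_radialSet.2 ⟨hq, Or.inr (Or.inl rfl)⟩

theorem before_of_mem_radialSet {σ : ℝ} {S : Finset Plane} {x q t : Plane}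
    (ht : t ∈ radialSet σ S x q) (htx : t ≠ x) (htq : t ≠ q) : 0 < σ * orient x t q := by
  rcases (mem_radialSet.1 ht).2 with h | h | h
  · exact absurd h htx
  · exact absurd h htq
  · exact h

/-- Rotate the line `xq` slightly about `q`, so that `x` falls on the side of the earlier points. -/
theorem radial_split {σ : ℝ} (hσ : IsSense σ) {S : Finset Plane} (hS : GenPos S) {x q : Plane}
    (hx : x ∈ S) (hq : q ∈ S) (hqx : q ≠ x) :
    Split S (radialSet σ S x q) (insert q (S \ radialSet σ S x q)) q := by
  have h := split_of_tie (S := S) (A := ((radialSet σ S x q).erase q).erase x)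
    (Z := S \ radialSet σ S x q) hqx (coeff_radial_ne_zero hσ hqx) (c :=
      lin (-σ * (q 1 - x 1)) (σ * (q 0 - x 0)) x)
    (by rw [lin_radial, orient_self_right, mul_zero, add_zero]) rfl
    (fun t ht => by
      rw [Finset.mem_erase, Finset.mem_erase] at ht
      have := before_of_mem_radialSet ht.2.2 ht.1 ht.2.1
      rw [lin_radial, orient_swap]
      linarith)
    (fun t ht => by
      rw [Finset.mem_sdiff] at ht
      have := (notMem_radialSet hσ hS hx hq hqx ht.1).1 ht.2
      rw [lin_radial σ x q t]
      linarith)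
    (by
      ext t
      simp only [Finset.mem_insert, Finset.mem_union, Finset.mem_erase, Finset.mem_sdiff]
      constructor
      · rintro (rfl | rfl | ⟨-, -, h⟩ | ⟨h, -⟩)
        · exact hq
        · exact hx
        · exact radialSet_subset _ _ _ _ h
        · exact h
      · intro h; tauto)
  rwa [Finset.insert_erase, Finset.insert_erase] at h
  · exact right_mem_radialSet hq
  · exact Finset.mem_erase.2 ⟨hqx.symm, left_mem_radialSet hx⟩

/-- Ensures that a radial set cut off at a point of the other colour is never special. -/
theorem radial_adjacent {σ : ℝ} {S : Finset Plane} {x q : Plane}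
    (hx : x ∈ S) (hq : q ∈ S) (hqx : q ≠ x) : HullEdge (-σ) (radialSet σ S x q) x q := by
  refine ⟨left_mem_radialSet hx, right_mem_radialSet hq, hqx.symm, fun t ht htx htq => ?_⟩
  have := before_of_mem_radialSet ht htx htq
  rw [orient_swap]; linarith

theorem sum_radialSet_of_hullEdge {σ : ℝ} {χ : Plane → ℤ} {S : Finset Plane} {x q : Plane}
    (h : HullEdge σ S x q) : ∑ p ∈ radialSet σ S x q, χ p = χ x + χ q := by
  have : radialSet σ S x q = {x, q} := by
    ext t
    rw [mem_radialSet, Finset.mem_insert, Finset.mem_singleton]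
    constructor
    · rintro ⟨ht, h1 | h1 | h1⟩
      · exact Or.inl h1
      · exact Or.inr h1
      · have h2 := before_ne h1
        exact absurd (h.2.2.2 t ht h2.1 h2.2.2) (before_asymm h1)
    · rintro (rfl | rfl)
      · exact ⟨h.1, Or.inl rfl⟩
      · exact ⟨h.2.1, Or.inr (Or.inl rfl)⟩
  rw [this, Finset.sum_pair h.2.2.1]

theorem firstBalanced_of_hullEdge {σ : ℝ} {χ : Plane → ℤ} {S : Finset Plane} {x q : Plane}
    (h : HullEdge σ S x q) (hχ : χ x + χ q = 0) : FirstBalanced σ χ S x q := by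
  refine ⟨h.2.1, h.2.2.1.symm, by rw [sum_radialSet_of_hullEdge h, hχ], fun p hp hpx hb => ?_⟩
  exact absurd (h.2.2.2 p hp hpx (before_ne hb).2.2) (before_asymm hb)

/-! ### Balanced sets -/

section Even

variable {G : SimpleGraph Plane} {S : Finset Plane} {χ : Plane → ℤ}

theorem even_of_firstBalanced_before {σ : ℝ} (hσ : IsSense σ) (hE : ∀ T ⊂ S, EvenGoal G T)
    (hO : ∀ T ⊂ S, OddGoal G T) (hc : Config G χ S) (hsum : ∑ p ∈ S, χ p = 0) {r b x : Plane}
    (hr : r ∈ S) (hb : b ∈ S) (hχr : χ r = 1) (hχb : χ b = -1) (hre : Extreme S r)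
    (hbe : Extreme S b) (hx : FirstBalanced σ χ S r x) (hχx : χ x = -1)
    (hxb : 0 < σ * orient r x b) :
    ∃ k, HasPath G S r b k ∧ 2 * (k + tau 1 χ S) ≤ S.card := by
  have hs := radial_split hσ hc.gen hr hx.1 hx.2.1
  refine even_of_split hE hO hc hsum hs hχx hx.2.2.1 (left_mem_radialSet hr) hχr ?_
    (before_ne hxb).2.2.symm hχb hre hbe
    (not_special_of_hullEdge hσ.neg (radial_adjacent hr hx.1 hx.2.1) hχx)
  rw [Finset.mem_insert, Finset.mem_sdiff]
  exact Or.inr ⟨hb, (notMem_radialSet hσ hc.gen hr hx.1 hx.2.1 hb).2 hxb⟩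

/-- If the balance point `x` comes after `b`, the closed side of `rx` not containing `b` is balanced
too, as `r` and `x` have opposite colours. The balance point in the opposite sense is therefore met
no later than `x`, and so before `b`. -/
theorem even_of_not_firstBalanced {σ : ℝ} (hσ : IsSense σ) (hE : ∀ T ⊂ S, EvenGoal G T)
    (hO : ∀ T ⊂ S, OddGoal G T) (hc : Config G χ S) (hsum : ∑ p ∈ S, χ p = 0) {r b : Plane}
    (hr : r ∈ S) (hb : b ∈ S) (hχr : χ r = 1) (hχb : χ b = -1) (hre : Extreme S r)
    (hbe : Extreme S b) (hnb : ¬ FirstBalanced σ χ S r b) :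
    ∃ k, HasPath G S r b k ∧ 2 * (k + tau 1 χ S) ≤ S.card := by
  obtain ⟨x, hx, hχx⟩ := exists_firstBalanced_of_sum_eq_zero hσ hc.color hc.gen hr hre hχr hsum
  have hxb : x ≠ b := by rintro rfl; exact hnb hx
  have hbr : b ≠ r := by rintro rfl; omega
  rcases before_total hσ (hc.gen r hr x hx.1 b hb hx.2.1.symm hxb hbr.symm) with h | h
  · exact even_of_firstBalanced_before hσ hE hO hc hsum hr hb hχr hχb hre hbe hx hχx h
  · obtain ⟨x', hx', hχx'⟩ :=
      exists_firstBalanced_of_sum_eq_zero hσ.neg hc.color hc.gen hr hre hχr hsum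
    have hbal : ∑ p ∈ radialSet (-σ) S r x, χ p = 0 := by
      have h1 := sum_radialSet_add_neg (χ := χ) hσ hc.gen hr hx.1 hx.2.1
      rw [hx.2.2.1, hsum, hχr, hχx] at h1
      omega
    have hbx' : 0 < σ * orient r b x' := by
      by_cases hxx : x' = x
      · rwa [hxx]
      · rcases before_total hσ
          (hc.gen r hr x hx.1 x' hx'.1 hx.2.1.symm (Ne.symm hxx) hx'.2.1.symm) with h1 | h1
        · exact before_trans hre hb hx.1 hx'.1 h h1
        · refine absurd hbal (hx'.2.2.2 x hx.1 hx.2.1 ?_)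
          rw [orient_swap]; linarith
    refine even_of_firstBalanced_before hσ.neg hE hO hc hsum hr hb hχr hχb hre hbe hx' hχx' ?_
    rw [orient_swap]; linarith

/-- If the first balance point against the sense of a hull edge `x y` is `y`, then the point after
`y` has the colour of `y`. -/
theorem second_color {σ : ℝ} (hσ : IsSense σ) (hχ : IsColoring χ) (hS : GenPos S)
    (hsum : ∑ p ∈ S, χ p = 0) {x y q : Plane} (hxy : HullEdge σ S x y) (hχx : χ x = 1)
    (hχy : χ y = -1) (hbal : FirstBalanced (-σ) χ S x y) (hq : q ∈ (S.erase x).erase y)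
    (hfirst : ∀ t ∈ (S.erase x).erase y, t ≠ q → 0 < σ * orient x q t) : χ q = -1 := by
  rcases hχ q with hχq | hχq
  swap
  · exact hχq
  exfalso
  have hxS := hxy.1
  have hyS := hxy.2.1
  have hq' := hq
  rw [Finset.mem_erase, Finset.mem_erase] at hq'
  have hsum' : χ x + (χ y + (χ q + ∑ p ∈ ((S.erase x).erase y).erase q, χ p)) = 0 := by
    rw [Finset.add_sum_erase _ _ hq, Finset.add_sum_erase _ _
      (Finset.mem_erase.2 ⟨hxy.2.2.1.symm, hyS⟩), Finset.add_sum_erase _ _ hxS, hsum]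
  have hne : (((S.erase x).erase y).erase q).Nonempty := by
    rw [Finset.nonempty_iff_ne_empty]
    intro h
    rw [h, Finset.sum_empty] at hsum'
    omega
  obtain ⟨p, hp, hpf⟩ := exists_first hσ hS hxS hxy.extreme_left _
    (((Finset.erase_subset _ _).trans (Finset.erase_subset _ _)).trans (Finset.erase_subset _ _))
    (by simp) hne
  have hp' := hp
  rw [Finset.mem_erase, Finset.mem_erase, Finset.mem_erase] at hp'
  -- With `q` of colour 1, the points `x`, `y`, `q` have sum 1; passing to the complement at the
  -- next point `p` gives a balanced radial set in the sense `-σ` that ends before `y`.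
  have hK : S.filter (fun t => 0 < σ * orient x t p) = {y, q} := by
    ext t
    rw [Finset.mem_filter, Finset.mem_insert, Finset.mem_singleton]
    constructor
    · rintro ⟨ht, hb⟩
      by_contra hcon
      push Not at hcon
      refine before_asymm hb (hpf t ?_ (before_ne hb).2.2)
      simp [hcon, ht, (before_ne hb).1]
    · rintro (rfl | rfl)
      · exact ⟨hyS, hxy.2.2.2 p hp'.2.2.2 hp'.2.2.1 hp'.2.1⟩
      · exact ⟨hq'.2.2, hfirst p (by simp [hp']) hp'.1⟩
  have h1 := sum_radialSet (σ := σ) (χ := χ) hxS hp'.2.2.2 hp'.2.2.1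
  rw [hK, Finset.sum_pair hq'.1.symm, hχx, hχy, hχq] at h1
  have h2 := sum_radialSet_add_neg (χ := χ) hσ hS hxS hp'.2.2.2 hp'.2.2.1
  rw [h1, hsum, hχx] at h2
  refine hbal.2.2.2 p hp'.2.2.2 hp'.2.2.1 ?_ (by omega)
  have := hxy.2.2.2 p hp'.2.2.2 hp'.2.2.1 hp'.2.1
  rw [orient_swap]; linarith

/-- A neighbour of the opposite colour would itself be the balance point, at the first step. The
third point `t` keeps the two hull neighbours of `x` distinct. -/
theorem outer_color {σ : ℝ} (hχ : IsColoring χ) {x y z t : Plane}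
    (hxy : HullEdge σ S x y) (hχx : χ x = 1)
    (hbal : FirstBalanced (-σ) χ S x y) (ht : t ∈ S) (htx : t ≠ x) (hty : t ≠ y)
    (hz : HullEdge (-σ) S x z) : χ z = 1 := by
  rcases hχ z with h | h
  · exact h
  exfalso
  have hzy : z ≠ y := by
    rintro rfl
    have h1 := hxy.2.2.2 t ht htx hty
    have h2 := hz.2.2.2 t ht htx hty
    linarith
  refine hbal.2.2.2 z hz.2.1 hz.2.2.1.symm (hz.2.2.2 y hxy.2.1 hxy.2.2.1.symm hzy.symm) ?_
  rw [sum_radialSet_of_hullEdge hz, hχx, h]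
  rfl

/-- The orientation of `p`, `q`, `t` is a nonzero factor, the same for all `t`, times the depth of
`t` below the line; the sign of that factor decides the sense. -/
theorem hullEdge_of_tie {T : Finset Plane} {a b : ℝ} (hab : a ≠ 0 ∨ b ≠ 0) {p q : Plane}
    (hp : p ∈ T) (hq : q ∈ T) (hpq : p ≠ q) (he : lin a b p = lin a b q)
    (hlt : ∀ t ∈ T, t ≠ p → t ≠ q → lin a b t < lin a b p) :
    ∃ σ, IsSense σ ∧ HullEdge σ T p q := by
  have hn : 0 < a ^ 2 + b ^ 2 := by
    rcases hab with h | h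
    · have := sq_nonneg b; positivity
    · have := sq_nonneg a; positivity
  have key : ∀ t, (a ^ 2 + b ^ 2) * orient p q t =
      ((q 0 - p 0) * b - (q 1 - p 1) * a) * (lin a b t - lin a b p) := by
    intro t
    have : (a ^ 2 + b ^ 2) * orient p q t =
      ((q 0 - p 0) * b - (q 1 - p 1) * a) * (lin a b t - lin a b p) -
      ((t 0 - p 0) * b - (t 1 - p 1) * a) * (lin a b q - lin a b p) := by
      unfold lin orient; ring
    rw [this, he]; ring
  rcases lt_trichotomy ((q 0 - p 0) * b - (q 1 - p 1) * a) 0 with h | h | h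
  · refine ⟨1, Or.inl rfl, hp, hq, hpq, fun t ht htp htq => ?_⟩
    have h1 := mul_pos_of_neg_of_neg h (sub_neg.2 (hlt t ht htp htq))
    rw [← key] at h1
    rw [one_mul]
    exact (pos_iff_pos_of_mul_pos h1).1 hn
  · exfalso
    have h' : a * (q 0 - p 0) + b * (q 1 - p 1) = 0 := by unfold lin at he; linarith
    have e0 : (a ^ 2 + b ^ 2) * (q 0 - p 0) = 0 := by linear_combination a * h' + b * h
    have e1 : (a ^ 2 + b ^ 2) * (q 1 - p 1) = 0 := by linear_combination b * h' - a * h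
    have f0 := (mul_eq_zero.1 e0).resolve_left hn.ne'
    have f1 := (mul_eq_zero.1 e1).resolve_left hn.ne'
    exact hpq (plane_ext (by linarith) (by linarith))
  · refine ⟨-1, Or.inr rfl, hp, hq, hpq, fun t ht htp htq => ?_⟩
    have h1 := mul_neg_of_pos_of_neg h (sub_neg.2 (hlt t ht htp htq))
    rw [← key] at h1
    have h2 : 0 < (a ^ 2 + b ^ 2) * (-1 * orient p q t) := by linarith
    exact (pos_iff_pos_of_mul_pos h2).1 hn

/-- The balance conditions make the colour next to `rb` blue as seen from `r` and red as seen from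
`b`. Hence some bichromatic hull edge of the remaining points faces both `r` and `b`, and the path
of the remaining points is extended from its ends. -/
theorem even_of_hullEdge {σ : ℝ} (hσ : IsSense σ) (hE : ∀ T ⊂ S, EvenGoal G T)
    (hc : Config G χ S) (hsum : ∑ p ∈ S, χ p = 0) {r b : Plane}
    (hrb : HullEdge σ S r b) (hχr : χ r = 1) (hχb : χ b = -1)
    (hbr : FirstBalanced (-σ) χ S r b) (hbb : FirstBalanced σ χ S b r) :
    ∃ k, HasPath G S r b k ∧ 2 * (k + tau 1 χ S) ≤ S.card := by
  have hr := hrb.1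
  have hb := hrb.2.1
  have hne := hrb.2.2.1
  have hS : insert r (insert b ((S.erase r).erase b)) = S := by
    rw [Finset.insert_erase (Finset.mem_erase.2 ⟨hne.symm, hb⟩), Finset.insert_erase hr]
  have hcard : ((S.erase r).erase b).card + 2 = S.card := by
    rw [← Finset.card_erase_add_one hr,
      ← Finset.card_erase_add_one (Finset.mem_erase.2 ⟨hne.symm, hb⟩)]
  rw [tau_sense isSense_one hσ hc.color hc.gen]
  have hadj : ∀ p ∈ S, ∀ q ∈ S, χ p = 1 → χ q = -1 → G.Adj p q := fun p hp q hq h1 h2 =>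
    hc.adj p hp q hq (by omega)
  rcases ((S.erase r).erase b).eq_empty_or_nonempty with hT | hT
  · rw [hT] at hS
    refine ⟨0, ?_, ?_⟩
    · rw [← hS]
      exact hasPath_pair (hadj r hr b hb hχr hχb)
    · have h1 : changes σ χ S ⊆ {(b, r)} := by
        rintro ⟨p, q⟩ h
        rw [mem_changes] at h
        have hp := h.2.2.1
        have hq := h.2.2.2.1
        simp only [← hS, Finset.mem_insert, Finset.notMem_empty, or_false] at hp hq
        have hp' : p = b := hp.resolve_left (by rintro rfl; simp only at h; omega)
        have hq' : q = r := hq.resolve_right (by rintro rfl; simp only at h; omega)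
        simp [hp', hq']
      have h2 := Finset.card_le_card h1
      rw [card_changes, Finset.card_singleton] at h2
      omega
  · have hTS : (S.erase r).erase b ⊆ S :=
      (Finset.erase_subset _ _).trans (Finset.erase_subset _ _)
    have hTS' : (S.erase r).erase b ⊂ S :=
      (Finset.ssubset_iff_of_subset hTS).2 ⟨r, hr, by simp⟩
    have hcomm : (S.erase b).erase r = (S.erase r).erase b := Finset.erase_right_comm
    have hbr' : HullEdge (-σ) S b r := hrb.symm
    have hbb' : FirstBalanced (- -σ) (-χ) S b r := by rw [neg_neg]; exact hbb.neg
    obtain ⟨q, hq, hqf⟩ := exists_first hσ hc.gen hr hrb.extreme_left _ hTS (by simp) hT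
    obtain ⟨s, hs, hsf⟩ := exists_first hσ.neg hc.gen hb hrb.extreme_right _ hTS (by simp) hT
    have hχq : χ q = -1 := second_color hσ hc.color hc.gen hsum hrb hχr hχb hbr hq hqf
    have hχs : χ s = 1 := by
      have := second_color (χ := -χ) hσ.neg hc.color.neg hc.gen (by simp [hsum]) hbr'
        (by simp [hχb]) (by simp [hχr]) hbb' (hcomm ▸ hs) (hcomm ▸ hsf)
      simpa using this
    obtain ⟨t0, ht0⟩ := hT
    have ht0' := ht0
    rw [Finset.mem_erase, Finset.mem_erase] at ht0'
    -- No counted change involves `r` or `b`: their other hull neighbours have their own colours,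
    -- and `rb`, traversed in the sense `σ`, goes from red to blue. So all changes survive the
    -- deletion.
    have htau : tau σ χ S ≤ tau σ χ ((S.erase r).erase b) := by
      rw [← card_changes, ← card_changes]
      refine Finset.card_le_card ?_
      rintro ⟨u, v⟩ h
      rw [mem_changes] at h ⊢
      obtain ⟨hu, hv, he⟩ := h
      simp only at hu hv he
      have hur : u ≠ r := by rintro rfl; omega
      have hvb : v ≠ b := by rintro rfl; omega
      have hvr : v ≠ r := by
        rintro rfl
        have := outer_color hc.color hrb hχr hbr ht0'.2.2 ht0'.2.1 ht0'.1 he.symm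
        omega
      have hub : u ≠ b := by
        rintro rfl
        have := outer_color (χ := -χ) hc.color.neg hbr' (by simp [hχb]) hbb' ht0'.2.2 ht0'.1
          ht0'.2.1 (z := v) (by rw [neg_neg]; exact he)
        simp only [Pi.neg_apply] at this
        omega
      exact ⟨hu, hv, he.mono hTS (by simp [hur, hub, he.1]) (by simp [hvr, hvb, he.2.1])⟩
    have hq' := hq
    have hs' := hs
    rw [Finset.mem_erase, Finset.mem_erase] at hq' hs'
    have hf := lin_radial (-σ) r q
    have hg := lin_radial σ b s
    have hfq := hf q
    have hgs := hg s
    rw [orient_self_right, mul_zero, add_zero] at hfq hgs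
    have hgr := hg r
    have hfb := hf b
    have ogr : 0 < σ * orient b s r := by
      rw [← orient_rotate]
      exact hrb.2.2.2 s hs'.2.2 hs'.2.1 hs'.1
    have ofb : 0 < -σ * orient r q b := by
      rw [orient_swap]
      linarith [hrb.2.2.2 q hq'.2.2 hq'.2.1 hq'.1]
    set a := - -σ * (q 1 - r 1)
    set a' := -σ * (q 0 - r 0)
    set d := -σ * (s 1 - b 1)
    set d' := σ * (s 0 - b 0)
    have hfle : ∀ t ∈ (S.erase r).erase b, t ≠ q → lin a a' t < lin a a' r := fun t ht htq => by
      have := hqf t ht htq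
      rw [hf]; linarith
    have hgle : ∀ t ∈ (S.erase r).erase b, t ≠ s → lin d d' t < lin d d' b := fun t ht hts => by
      have := hsf t ht hts
      rw [hg]; linarith
    -- One functional is constant on the line `rq` and maximal on the rest at the blue `q`, the
    -- other is constant on `bs` and maximal there at the red `s`. At the first tie, `r` and `b` lie
    -- strictly beyond the line: neither functional is smaller at `r` or `b` than on the rest, and
    -- for each of the two points one of them is strictly larger.
    obtain ⟨τ, hτ0, hτ1, p', hp', q', hq'', htie, hA, hB, -⟩ :=
      exists_tie (A := ((S.erase r).erase b).filter fun z => χ z = -1)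
        (B := ((S.erase r).erase b).filter fun z => χ z = 1) (f := lin a a') (g := lin d d')
        (fun z hz => ⟨q, by simp only [Finset.mem_filter]; exact ⟨hq, hχq⟩, by
          rw [Finset.mem_filter] at hz
          rw [hfq]
          exact hfle z hz.1 (by rintro rfl; omega)⟩)
        ⟨s, by simp only [Finset.mem_filter]; exact ⟨hs, hχs⟩, fun z hz => by
          rw [Finset.mem_filter] at hz
          rw [hgs]
          exact hgle z hz.1 (by rintro rfl; omega)⟩
    rw [Finset.mem_filter] at hp' hq''
    have hmax : ∀ z ∈ (S.erase r).erase b, (1 - τ) * lin a a' z + τ * lin d d' z ≤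
        (1 - τ) * lin a a' p' + τ * lin d d' p' := by
      intro z hz
      rcases hc.color z with h | h
      · exact hB z (Finset.mem_filter.2 ⟨hz, h⟩)
      · exact hA z (Finset.mem_filter.2 ⟨hz, h⟩)
    have hfle' : ∀ t ∈ (S.erase r).erase b, lin a a' t ≤ lin a a' r := fun t ht => by
      by_cases h : t = q
      · rw [h, hfq]
      · exact (hfle t ht h).le
    have hgle' : ∀ t ∈ (S.erase r).erase b, lin d d' t ≤ lin d d' b := fun t ht => by
      by_cases h : t = s
      · rw [h, hgs]
      · exact (hgle t ht h).le
    have hτ1' : 0 < 1 - τ := sub_pos.2 hτ1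
    have hrgt : (1 - τ) * lin a a' p' + τ * lin d d' p' <
        (1 - τ) * lin a a' r + τ * lin d d' r := by
      have h1 := mul_le_mul_of_nonneg_left (hfle' p' hp'.1) hτ1'.le
      have h2 : lin d d' p' < lin d d' r := by
        have := hgle' p' hp'.1
        linarith
      have := mul_lt_mul_of_pos_left h2 hτ0
      linarith
    have hbgt : (1 - τ) * lin a a' p' + τ * lin d d' p' <
        (1 - τ) * lin a a' b + τ * lin d d' b := by
      have h1 := mul_le_mul_of_nonneg_left (hgle' p' hp'.1) hτ0.le
      have h2 : lin a a' p' < lin a a' b := by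
        have := hfle' p' hp'.1
        linarith
      have := mul_lt_mul_of_pos_left h2 hτ1'
      linarith
    simp only [lin_interpolate] at htie hmax hrgt hbgt
    set e := (1 - τ) * a + τ * d
    set e' := (1 - τ) * a' + τ * d'
    have hab := coeff_ne_zero_of_lin_lt hrgt
    have hpq' : p' ≠ q' := by rintro rfl; omega
    obtain ⟨σ', hσ', hedge⟩ := hullEdge_of_tie hab hq''.1 hp'.1 hpq'.symm htie.symm
      (fun t ht h1 h2 => by
        rw [← htie]
        exact lt_of_le_of_tie hc.gen hab (hTS hp'.1) (hTS hq''.1) (hTS ht) hpq' h1.symm h2.symm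
          htie (hmax t ht))
    obtain ⟨k, hk, hk'⟩ := hE _ hTS' χ (hc.mono hTS) (by
        have h1 := Finset.add_sum_erase S χ hr
        have h2 := Finset.add_sum_erase (S.erase r) χ (Finset.mem_erase.2 ⟨hne.symm, hb⟩)
        omega) q' hq''.1 p' hp'.1 hq''.2 hp'.2 hedge.extreme_left hedge.extreme_right
      (not_special_of_hullEdge hσ' hedge hp'.2)
    rw [tau_sense isSense_one hσ hc.color (hc.gen.mono hTS)] at hk'
    refine ⟨1 + k, ?_, by omega⟩
    have := hk.reverse.extend (u := r) (v := b) (hadj r hr p' (hTS hp'.1) hχr hp'.2)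
      (hadj q' (hTS hq''.1) b hb hq''.2 hχb) hne (a := -e) (b := -e') (c := -lin e e' p')
      (by rw [lin_neg]; linarith) (by rw [lin_neg]; linarith) (by rw [lin_neg])
      (by rw [lin_neg, htie]) (fun t ht => by rw [lin_neg]; linarith [hmax t ht])
    rwa [hS] at this

theorem even_step (hE : ∀ T ⊂ S, EvenGoal G T) (hO : ∀ T ⊂ S, OddGoal G T) : EvenGoal G S := by
  intro χ hc hsum r hr b hb hχr hχb hre hbe hns
  by_cases h1 : ∀ σ, IsSense σ → FirstBalanced σ χ S r b
  swap
  · push Not at h1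
    obtain ⟨σ, hσ, h⟩ := h1
    exact even_of_not_firstBalanced hσ hE hO hc hsum hr hb hχr hχb hre hbe h
  by_cases h2 : ∀ σ, IsSense σ → FirstBalanced σ χ S b r
  swap
  · push Not at h2
    obtain ⟨σ, hσ, h⟩ := h2
    obtain ⟨k, hk, hk'⟩ := even_of_not_firstBalanced (χ := -χ) hσ hE hO hc.neg (by simp [hsum])
      hb hr (by simp [hχb]) (by simp [hχr]) hbe hre (fun h' => h (by simpa using h'.neg))
    rw [tau_neg_coloring isSense_one hc.color hc.gen] at hk'
    exact ⟨k, hk.reverse, hk'⟩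
  -- A hull neighbour of the opposite colour is a balance point at once, so it would be `b` (or
  -- `r`). If `rb` is no hull edge, all neighbours thus share the colour of their point, and the
  -- configuration is special.
  have key : ∃ σ, IsSense σ ∧ HullEdge σ S r b := by
    by_contra hcon
    push Not at hcon
    refine hns ⟨fun σ hσ q hq => ?_, fun σ hσ q hq => ?_, h1, h2⟩
    · rcases hc.color q with h | h
      · exact h
      · exfalso
        have := (firstBalanced_of_hullEdge hq (χ := χ) (by rw [hχr, h]; rfl)).unique hσ hc.gen hr
          (h1 σ hσ)
        exact hcon σ hσ (this ▸ hq)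
    · rcases hc.color q with h | h
      · exfalso
        have := (firstBalanced_of_hullEdge hq (χ := χ) (by rw [hχb, h]; rfl)).unique hσ hc.gen hb
          (h2 σ hσ)
        exact hcon (-σ) hσ.neg (this ▸ hq).symm
      · exact h
  obtain ⟨σ, hσ, h⟩ := key
  exact even_of_hullEdge hσ hE hc hsum h hχr hχb (h1 _ hσ.neg) (h2 _ hσ)

end Even

/-! ### Inner common tangents -/

/-- Rotating a line that separates two sets, one reaches a common tangent. -/
theorem exists_inner_tangent {A B : Finset Plane} {a b a' b' : ℝ} {r x : Plane}
    (hx : x ∈ A) (hrx : lin a b r = lin a b x) (hA : ∀ t ∈ A, lin a b t ≤ lin a b x)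
    (hB : ∀ t ∈ B, lin a b x < lin a b t) (hB0 : B.Nonempty) (hlt : lin a' b' r < lin a' b' x) :
    ∃ d d', lin d d' r < lin d d' x ∧ ∃ p ∈ A, ∃ q ∈ B, lin d d' p = lin d d' q ∧
      (∀ t ∈ A, lin d d' t ≤ lin d d' p) ∧ ∀ t ∈ B, lin d d' p ≤ lin d d' t := by
  set F : ℝ → Plane → ℝ := fun s z => Real.cos s * lin a b z + Real.sin s * lin a' b' z with hF
  have hcont : ∀ z, Continuous fun s => F s z := fun z => by simp only [hF]; fun_prop
  set T : Set ℝ := {s | ∃ p ∈ A, ∃ q ∈ B, F s q ≤ F s p} with hT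
  have hclosed : IsClosed T := by
    have : T = ⋃ p ∈ A, ⋃ q ∈ B, {s | F s q ≤ F s p} := by
      ext s; simp [hT]
    rw [this]
    exact isClosed_biUnion_finset fun p _ => isClosed_biUnion_finset fun q _ =>
      isClosed_le (hcont q) (hcont p)
  have hcomp : IsCompact (Set.Icc (0 : ℝ) Real.pi ∩ T) := isCompact_Icc.inter_right hclosed
  obtain ⟨q0, hq0⟩ := hB0
  have hne : (Set.Icc (0 : ℝ) Real.pi ∩ T).Nonempty := by
    refine ⟨Real.pi, ⟨Real.pi_pos.le, le_rfl⟩, x, hx, q0, hq0, ?_⟩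
    simp only [hF, Real.cos_pi, Real.sin_pi]
    linarith [hB q0 hq0]
  obtain ⟨s, ⟨⟨hs0, hs1⟩, p, hp, q, hq, hpq⟩, hmin⟩ := hcomp.exists_isLeast hne
  have hspos : 0 < s := by
    rcases hs0.lt_or_eq with h | h
    · exact h
    · exfalso
      subst h
      simp only [hF, Real.cos_zero, Real.sin_zero] at hpq
      linarith [hA p hp, hB q hq]
  -- For parameters below `s` the sets are still separated, and weak separation passes to the limit.
  have hsep : ∀ u ∈ A, ∀ v ∈ B, F s u ≤ F s v := by
    intro u hu v hv
    have hmem : s ∈ closure (Set.Ioo 0 s) := by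
      rw [closure_Ioo hspos.ne]
      exact ⟨hspos.le, le_rfl⟩
    refine closure_minimal ?_ (isClosed_le (hcont u) (hcont v)) hmem
    intro t ht
    by_contra hcon
    have h1 := hmin (a := t) ⟨⟨ht.1.le, ht.2.le.trans hs1⟩, u, hu, v, hv, (not_le.1 hcon).le⟩
    exact absurd ht.2 (not_lt.2 h1)
  have heq : F s p = F s q := le_antisymm (hsep p hp q hq) hpq
  have hlin : ∀ z, lin (Real.cos s * a + Real.sin s * a') (Real.cos s * b + Real.sin s * b') z =
      F s z := by
    intro z; simp only [hF, lin]; ring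
  -- At angle π the functional is negated and separates the wrong way round. So `sin s` is positive
  -- and `x` lies strictly above `r`, which keeps `r` off the tangent.
  have hspi : s < Real.pi := by
    refine lt_of_le_of_ne hs1 fun h => ?_
    have h2 := hsep x hx q0 hq0
    simp only [hF, h, Real.cos_pi, Real.sin_pi] at h2
    linarith [hB q0 hq0]
  have hsin := Real.sin_pos_of_pos_of_lt_pi hspos hspi
  refine ⟨Real.cos s * a + Real.sin s * a', Real.cos s * b + Real.sin s * b', ?_, p, hp, q, hq, ?_, fun t ht => ?_, fun t ht => ?_⟩
  · rw [hlin, hlin]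
    simp only [hF, hrx]
    have := mul_lt_mul_of_pos_left hlt hsin
    linarith
  · rw [hlin, hlin, heq]
  · rw [hlin, hlin, heq]
    exact hsep t ht q hq
  · rw [hlin, hlin]
    exact hsep p hp t ht

/-! ### Sets with one excess point -/

section Odd

variable {G : SimpleGraph Plane} {S : Finset Plane} {χ : Plane → ℤ}

theorem filter_before_down {σ : ℝ} {x y : Plane} (hx : Extreme S x) (hy : y ∈ S) :
    ∀ q ∈ S.filter (fun p => 0 < σ * orient x p y), ∀ p ∈ S, 0 < σ * orient x p q →
      p ∈ S.filter (fun p => 0 < σ * orient x p y) := by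
  intro q hq p hp hb
  rw [Finset.mem_filter] at hq ⊢
  exact ⟨hp, before_trans hx hp hq.1 hy hb hq.2⟩

/-- If the hull point next to `r` is blue and there is an excess of red points on that side of
`r'`, then a line through `r` and another red point splits the problem. -/
theorem odd_of_blue_neighbor {σ : ℝ} (hσ : IsSense σ) (hO : ∀ T ⊂ S, OddGoal G T)
    (hc : Config G χ S) (hsum : ∑ p ∈ S, χ p = 1) {r r' z : Plane} (hr : r ∈ S) (hr' : r' ∈ S)
    (hne : r ≠ r') (hχr : χ r = 1) (hχr' : χ r' = 1) (hre : Extreme S r) (hre' : Extreme S r')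
    (hz : HullEdge σ S r z) (hχz : χ z = -1)
    (hK : 0 ≤ ∑ p ∈ S.filter (fun p => 0 < σ * orient r p r'), χ p) :
    ∃ k, HasPath G S r r' k ∧ 2 * (k + tau 1 χ S) + 1 ≤ S.card := by
  have hzr' : z ≠ r' := by rintro rfl; omega
  have hzK : z ∈ S.filter (fun p => 0 < σ * orient r p r') :=
    Finset.mem_filter.2 ⟨hz.2.1, hz.2.2.2 r' hr' hne.symm hzr'.symm⟩
  have hrK : r ∉ S.filter (fun p => 0 < σ * orient r p r') := by simp
  have hdown := filter_before_down (σ := σ) hre hr'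
  obtain ⟨l, hl, hlast⟩ := exists_last hσ hc.gen hr hre _ (Finset.filter_subset _ _) hrK ⟨z, hzK⟩
  -- The partial sums are 0 at the blue `z` and at least 1 at the end of the segment before `r'`;
  -- their first value 1 is attained at a red point.
  obtain ⟨q, hq, h1, -, h3⟩ := exists_first_sum_le hσ (χ := -χ) hc.gen hr hre (-1)
    (Finset.filter_subset _ _) hrK hdown ⟨l, hl, by
      rw [sum_radialSet_last hr (Finset.filter_subset _ _) hrK hdown hl hlast]
      simp only [Pi.neg_apply, Finset.sum_neg_distrib]
      omega⟩
  simp only [Pi.neg_apply, Finset.sum_neg_distrib] at h1 h3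
  have hqS := (Finset.mem_filter.1 hq).1
  have hqb := (Finset.mem_filter.1 hq).2
  have hqr := (before_ne hqb).1
  have hχq : χ q = 1 ∧ ∑ p ∈ radialSet σ S r q, χ p = 1 := by
    rcases h3 with h3 | ⟨h3, h4⟩
    · rcases hc.color q with h | h <;> omega
    · exfalso
      have hqz : q = z := by
        by_contra hqz
        exact h4 z hz.2.1 (hz.2.2.2 q hqS hqr hqz)
      rw [hqz] at h1 h3
      omega
  refine odd_of_split_red hO hc hsum (radial_split hσ hc.gen hr hqS hqr) hχq.1 hχq.2
    (left_mem_radialSet hr) hqr.symm hχr ?_ (before_ne hqb).2.2.symm hχr' hre hre'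
  rw [Finset.mem_insert, Finset.mem_sdiff]
  exact Or.inr ⟨hr', (notMem_radialSet hσ hc.gen hr hqS hqr hr').2 hqb⟩

/-- Let `A` be the balanced radial set of `r` up to `x₁` and `Z` its complement, with inner common
tangent through `x` in `A` and `y` in `Z`. If `x` is red, an earlier supporting line of `A` gives a
red pivot in `A`. If `x` is blue, one of `x` and `y` is a pivot; splits at a blue pivot use the red
hull edge `zr`, which joins `Z` to `A`. -/
theorem odd_of_red_neighbor {σ : ℝ} (hσ : IsSense σ) (hE : ∀ T ⊂ S, EvenGoal G T)
    (hO : ∀ T ⊂ S, OddGoal G T)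
    (hc : Config G χ S) (hsum : ∑ p ∈ S, χ p = 1) {r r' z x₁ : Plane} (hr : r ∈ S) (hr' : r' ∈ S)
    (hχr : χ r = 1) (hχr' : χ r' = 1) (hre : Extreme S r) (hre' : Extreme S r')
    (hz : HullEdge (-σ) S r z) (hχz : χ z = 1)
    (hx₁ : FirstBalanced σ χ S r x₁) (hχx₁ : χ x₁ = -1) (hxr' : 0 < σ * orient r x₁ r') :
    ∃ k, HasPath G S r r' k ∧ 2 * (k + tau 1 χ S) + 1 ≤ S.card := by
  have hx₁S := hx₁.1
  have hx₁r := hx₁.2.1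
  have hmem := fun t ht => notMem_radialSet hσ hc.gen hr hx₁S hx₁r (p := t) ht
  have hA0 := hx₁.2.2.1
  have hAS := radialSet_subset σ S r x₁
  have hrA : r ∈ radialSet σ S r x₁ := left_mem_radialSet hr
  have hx₁A : x₁ ∈ radialSet σ S r x₁ := right_mem_radialSet hx₁S
  have hA1 : ∀ t ∈ radialSet σ S r x₁, t ≠ r → t ≠ x₁ → 0 < σ * orient r t x₁ :=
    fun t => before_of_mem_radialSet
  obtain ⟨A, hA⟩ : ∃ A, A = radialSet σ S r x₁ := ⟨_, rfl⟩
  rw [← hA] at hA0 hAS hrA hx₁A hA1 hmem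
  obtain ⟨Z, hZ⟩ : ∃ Z, Z = S \ A := ⟨_, rfl⟩
  have hZS : Z ⊆ S := hZ ▸ Finset.sdiff_subset
  have hAZ : A ∪ Z = S := by rw [hZ]; exact Finset.union_sdiff_of_subset hAS
  have hZmem : ∀ t, t ∈ Z ↔ t ∈ S ∧ 0 < σ * orient r x₁ t := by
    intro t
    rw [hZ, Finset.mem_sdiff]
    exact and_congr_right fun ht => hmem t ht
  have hdisj : ∀ t ∈ A, t ∉ Z := fun t ht ht' => (Finset.mem_sdiff.1 (hZ ▸ ht')).2 ht
  have hr'Z : r' ∈ Z := (hZmem r').2 ⟨hr', hxr'⟩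
  have hzZ : z ∈ Z := by
    have hne : z ≠ x₁ := by rintro rfl; omega
    refine (hZmem z).2 ⟨hz.2.1, ?_⟩
    have := hz.2.2.2 x₁ hx₁S hx₁r hne.symm
    rw [orient_swap]; linarith
  have hzr : HullEdge σ S z r := by simpa using hz.symm
  have hl := lin_radial σ r x₁
  have hlx := hl x₁
  rw [orient_self_right, mul_zero, add_zero] at hlx
  set a := -σ * (x₁ 1 - r 1)
  set b := σ * (x₁ 0 - r 0)
  have hAlt : ∀ t ∈ A, t ≠ r → t ≠ x₁ → lin a b t < lin a b x₁ := by
    intro t ht h1 h2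
    have := hA1 t ht h1 h2
    rw [hl t, hlx, orient_swap]; linarith
  have hAle : ∀ t ∈ A, lin a b t ≤ lin a b x₁ := by
    intro t ht
    by_cases h1 : t = r
    · rw [h1, hlx]
    · by_cases h2 : t = x₁
      · rw [h2]
      · exact (hAlt t ht h1 h2).le
  have hZlt : ∀ t ∈ Z, lin a b x₁ < lin a b t := by
    intro t ht
    have := ((hZmem t).1 ht).2
    rw [hl t, hlx]; linarith
  have hdir : lin (x₁ 0 - r 0) (x₁ 1 - r 1) r < lin (x₁ 0 - r 0) (x₁ 1 - r 1) x₁ := by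
    have e : lin (x₁ 0 - r 0) (x₁ 1 - r 1) x₁ - lin (x₁ 0 - r 0) (x₁ 1 - r 1) r =
        (x₁ 0 - r 0) ^ 2 + (x₁ 1 - r 1) ^ 2 := by unfold lin; ring
    have h0 : x₁ 0 - r 0 ≠ 0 ∨ x₁ 1 - r 1 ≠ 0 := by
      by_contra hcon
      push Not at hcon
      exact hx₁r (plane_ext (sub_eq_zero.1 hcon.1) (sub_eq_zero.1 hcon.2))
    rw [← sub_pos, e]
    rcases h0 with h | h
    · have := sq_nonneg (x₁ 1 - r 1); positivity
    · have := sq_nonneg (x₁ 0 - r 0); positivity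
  obtain ⟨d, d', hdr, x, hx, y, hy, hxy, hdA, hdZ⟩ :=
    exists_inner_tangent hx₁A hlx.symm hAle hZlt ⟨r', hr'Z⟩ hdir
  have hdd := coeff_ne_zero_of_lin_lt hdr
  have hxr : x ≠ r := by
    rintro rfl
    exact absurd hdr (not_lt.2 (hdA x₁ hx₁A))
  have hxney : x ≠ y := by rintro rfl; exact hdisj x hx hy
  have hdA' : ∀ t ∈ A, t ≠ x → lin d d' t < lin d d' x := fun t ht htx =>
    lt_of_le_of_tie hc.gen hdd (hAS hx) (hZS hy) (hAS ht) hxney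
      (by rintro rfl; exact hdisj y ht hy) htx.symm hxy (hdA t ht)
  have hdZ' : ∀ t ∈ Z, t ≠ y → lin d d' x < lin d d' t := by
    intro t ht hty
    have := lt_of_le_of_tie hc.gen (a := -d) (b := -d') (by simpa using hdd) (hAS hx) (hZS hy)
      (hZS ht) hxney hty.symm (by rintro rfl; exact hdisj x hx ht)
      (by rw [lin_neg, lin_neg, hxy]) (by rw [lin_neg, lin_neg]; linarith [hdZ t ht])
    rw [lin_neg, lin_neg] at this
    linarith
  rcases hc.color x with hχx | hχx
  -- Turning from the line `rx₁` to the tangent, the colour on top of `A` without `r` passes from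
  -- the blue `x₁` to the red `x`. The point `r` is excluded from the red candidates because it ties
  -- with `x₁` at the start.
  · obtain ⟨s, hs0, hs1, p', hp', q', hq', htie, hmA, hmB, -⟩ :=
      exists_tie (A := A.filter fun z => χ z = -1) (B := (A.erase r).filter fun z => χ z = 1)
        (f := lin a b) (g := lin d d')
        (fun q hq => ⟨x₁, Finset.mem_filter.2 ⟨hx₁A, hχx₁⟩, by
          rw [Finset.mem_filter, Finset.mem_erase] at hq
          exact hAlt q hq.1.2 hq.1.1 (by rintro rfl; omega)⟩)
        ⟨x, Finset.mem_filter.2 ⟨Finset.mem_erase.2 ⟨hxr, hx⟩, hχx⟩, fun p hp => by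
          rw [Finset.mem_filter] at hp
          exact hdA' p hp.1 (by rintro rfl; omega)⟩
    rw [Finset.mem_filter] at hp' hq'
    rw [Finset.mem_erase] at hq'
    have hs1' := sub_pos.2 hs1
    have hx₁le := hmA x₁ (Finset.mem_filter.2 ⟨hx₁A, hχx₁⟩)
    have hrlt : (1 - s) * lin a b r + s * lin d d' r <
        (1 - s) * lin a b p' + s * lin d d' p' := by
      have := mul_lt_mul_of_pos_left hdr hs0
      rw [← hlx]
      linarith
    have hmax : ∀ t ∈ A, (1 - s) * lin a b t + s * lin d d' t ≤
        (1 - s) * lin a b p' + s * lin d d' p' := by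
      intro t ht
      by_cases htr : t = r
      · rw [htr]; exact hrlt.le
      · rcases hc.color t with h | h
        · exact hmB t (Finset.mem_filter.2 ⟨Finset.mem_erase.2 ⟨htr, ht⟩, h⟩)
        · exact hmA t (Finset.mem_filter.2 ⟨ht, h⟩)
    have hZgt : ∀ t ∈ Z, (1 - s) * lin a b p' + s * lin d d' p' <
        (1 - s) * lin a b t + s * lin d d' t := by
      intro t ht
      have h1 := mul_lt_mul_of_pos_left ((hAle p' hp'.1).trans_lt (hZlt t ht)) hs1'
      have h2 := mul_le_mul_of_nonneg_left ((hdA p' hp'.1).trans (hdZ t ht)) hs0.le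
      linarith
    simp only [lin_interpolate] at htie hrlt hmax hZgt
    have hee := coeff_ne_zero_of_lin_lt hrlt
    have hpq : p' ≠ q' := by rintro rfl; omega
    -- Rotating about the red `q'` hands the blue `p'` over to the side of `Z`, so `A` without `p'`
    -- has sum 1.
    have hsplit := split_of_tie' (S := S) (A := (A.erase p').erase q') (Z := Z) hpq.symm hee
      htie.symm rfl
      (fun t ht => by
        rw [Finset.mem_erase, Finset.mem_erase] at ht
        exact lt_of_le_of_tie hc.gen hee (hAS hp'.1) (hAS hq'.1.2) (hAS ht.2.2) hpq ht.1.symm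
          ht.2.1.symm htie (hmax t ht.2.2))
      hZgt (by
        rw [← hAZ]
        ext t
        simp only [Finset.mem_insert, Finset.mem_union, Finset.mem_erase]
        constructor
        · rintro (rfl | rfl | h | h)
          · exact Or.inl hq'.1.2
          · exact Or.inl hp'.1
          · exact Or.inl h.2.2
          · exact Or.inr h
        · tauto)
    rw [Finset.insert_erase (Finset.mem_erase.2 ⟨hpq.symm, hq'.1.2⟩)] at hsplit
    refine odd_of_split_red hO hc hsum hsplit hq'.2 ?_ (Finset.mem_erase.2 ⟨?_, hrA⟩)
      hq'.1.1.symm hχr (by simp [hr'Z]) ?_ hχr' hre hre'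
    · have := Finset.add_sum_erase A χ hp'.1
      omega
    · rintro rfl; omega
    · rintro rfl; exact hdisj _ hq'.1.2 hr'Z
  · have hxZ : ∀ t, t ∈ Z → t ≠ x := fun t ht => by rintro rfl; exact hdisj t hx ht
    have hQ : insert y (insert x (A.erase x ∪ Z.erase y)) = S := by
      rw [← hAZ]
      ext t
      simp only [Finset.mem_insert, Finset.mem_union, Finset.mem_erase]
      constructor
      · rintro (rfl | rfl | h | h) <;> tauto
      · tauto
    have hQ' : insert x (insert y (A.erase x ∪ Z.erase y)) = S := by
      rw [Finset.insert_comm, hQ]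
    have hltA : ∀ t ∈ A.erase x, lin d d' t < lin d d' x := fun t ht =>
      hdA' t (Finset.mem_of_mem_erase ht) (Finset.ne_of_mem_erase ht)
    have hltZ : ∀ t ∈ Z.erase y, lin d d' x < lin d d' t := fun t ht =>
      hdZ' t (Finset.mem_of_mem_erase ht) (Finset.ne_of_mem_erase ht)
    -- A red `y` other than `r'` is a pivot at once: `A` together with `y` has sum 1.
    by_cases hyr : χ y = 1 ∧ y ≠ r'
    · have hsplit := split_of_tie hxney.symm hdd hxy.symm rfl hltA hltZ hQ
      rw [Finset.insert_erase hx, Finset.insert_erase hy] at hsplit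
      have hyA : y ∉ A := fun h => hdisj y h hy
      refine odd_of_split_red hO hc hsum hsplit hyr.1 ?_ (Finset.mem_insert_of_mem hrA)
        (by rintro rfl; exact hyA hrA) hχr hr'Z hyr.2.symm hχr' hre hre'
      rw [Finset.sum_insert hyA, hA0, hyr.1]
      rfl
    · by_cases hns : Special χ (insert x Z) r' x
      -- Were `y = r'`, the tangent would be a bichromatic hull edge of `insert x Z`, against
      -- specialness. So `y` is blue, and it can replace `x` as pivot with both parts balanced.
      · have hyr' : y ≠ r' := by
          rintro rfl
          obtain ⟨σ', hσ', hedge⟩ := hullEdge_of_tie (T := insert x Z) (a := -d) (b := -d')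
            (by simpa using hdd) (Finset.mem_insert_of_mem hy) (Finset.mem_insert_self x Z)
            hxney.symm (by rw [lin_neg, lin_neg, hxy]) (fun t ht h1 h2 => by
              rw [lin_neg, lin_neg, ← hxy]
              have := hdZ' t ((Finset.mem_insert.1 ht).resolve_left h2) h1
              linarith)
          exact not_special_of_hullEdge hσ' hedge hχx hns
        have hχy : χ y = -1 := by
          rcases hc.color y with h | h
          · exact absurd ⟨h, hyr'⟩ hyr
          · exact h
        have hsplit := split_of_tie' hxney.symm hdd hxy.symm rfl hltA hltZ hQ
        rw [Finset.insert_comm, Finset.insert_erase hy] at hsplit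
        have hyA : y ∉ A := fun h => hdisj y h hy
        refine odd_of_split_blue hE hc hsum hsplit hχy ?_
          (Finset.mem_insert_of_mem (Finset.mem_erase.2 ⟨hxr.symm, hrA⟩)) hχr
          (Finset.mem_insert_of_mem hr'Z) hχr' hre hre' hσ hzr (Finset.mem_insert_of_mem hzZ) hχz
          ?_ ?_
        · rw [Finset.sum_insert (fun h => hyA (Finset.mem_of_mem_erase h))]
          have := Finset.add_sum_erase A χ hx
          omega
        · refine not_special_of_hullEdge (σ := -σ) hσ.neg ⟨?_, ?_, ?_, fun t ht htr hty => ?_⟩ hχy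
          · exact Finset.mem_insert_of_mem (Finset.mem_erase.2 ⟨hxr.symm, hrA⟩)
          · exact Finset.mem_insert_self _ _
          · rintro rfl; exact hyA hrA
          · have htA := Finset.mem_of_mem_erase ((Finset.mem_insert.1 ht).resolve_left hty)
            have hy1 := ((hZmem y).1 hy).2
            have : 0 < σ * orient r t y := by
              by_cases htx : t = x₁
              · rwa [htx]
              · exact before_trans hre (hAS htA) hx₁S (hZS hy) (hA1 t htA htr htx) hy1
            rw [orient_swap]; linarith
        -- The set is again `insert x Z`; if it were special for `x` and for `y`, the balance point
        -- of `r'` would not be unique.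
        · intro hns'
          exact hxney (FirstBalanced.unique isSense_one
            (hc.gen.mono (Finset.insert_subset (hAS hx) hZS)) (Finset.mem_insert_of_mem hr'Z)
            (hns.around_red 1 isSense_one) (hns'.around_red 1 isSense_one))
      · have hsplit := split_of_tie' hxney hdd rfl hxy.symm hltA hltZ hQ'
        rw [Finset.insert_erase hx, Finset.insert_erase hy] at hsplit
        refine odd_of_split_blue hE hc hsum hsplit hχx hA0 hrA hχr
          (Finset.mem_insert_of_mem hr'Z) hχr' hre hre' hσ hzr (Finset.mem_insert_of_mem hzZ) hχz
          ?_ hns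
        by_cases hxx : x = x₁
        · subst hxx
          rw [hA]
          exact not_special_of_hullEdge hσ.neg (radial_adjacent hr hx₁S hx₁r) hχx
        -- In `A` the balance point of `r` would be `x`; as `A` is an initial radial segment of `S`,
        -- it would be balanced in `S` too, ahead of `x₁`.
        · intro hsp
          have hb := hA1 x hx hxr hxx
          refine hx₁.2.2.2 x (hAS hx) hxr hb ?_
          have hset : radialSet σ S r x = radialSet σ A r x := by
            ext t
            rw [mem_radialSet, mem_radialSet]
            refine and_congr_left fun ht => ⟨fun htS => ?_, fun htA => hAS htA⟩
            rcases ht with rfl | rfl | ht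
            · exact hrA
            · exact hx
            · rw [hA]
              exact mem_radialSet.2 ⟨htS, Or.inr (Or.inr
                (before_trans hre htS (hAS hx) hx₁S ht hb))⟩
          rw [hset]
          exact (hsp.around_red σ hσ).2.2.1

/-- The open sides of the line `rr'` have sums adding to -1, so one is negative and the other
nonnegative. The colour of the hull neighbour of `r` on the nonnegative side decides between the two
cases. -/
theorem odd_step (hE : ∀ T ⊂ S, EvenGoal G T) (hO : ∀ T ⊂ S, OddGoal G T) : OddGoal G S := by
  intro χ hc hsum r hr r' hr' hne hχr hχr' hre hre'
  have hside : ∑ p ∈ S.filter (fun p => 0 < (1 : ℝ) * orient r p r'), χ p +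
      ∑ p ∈ S.filter (fun p => 0 < (-1 : ℝ) * orient r p r'), χ p = -1 := by
    have h1 := sum_radialSet (σ := 1) (χ := χ) hr hr' hne.symm
    have h2 := sum_radialSet (σ := -1) (χ := χ) hr hr' hne.symm
    have h3 := sum_radialSet_add_neg (χ := χ) isSense_one hc.gen hr hr' hne.symm
    omega
  obtain ⟨σ, hσ, hK, hK'⟩ : ∃ σ, IsSense σ ∧
      1 + ∑ p ∈ S.filter (fun p => 0 < σ * orient r p r'), χ p ≤ 0 ∧
      0 ≤ ∑ p ∈ S.filter (fun p => 0 < -σ * orient r p r'), χ p := by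
    by_cases h : 1 + ∑ p ∈ S.filter (fun p => 0 < (1 : ℝ) * orient r p r'), χ p ≤ 0
    · exact ⟨1, isSense_one, h, by omega⟩
    · exact ⟨-1, isSense_one.neg, by omega, by rw [neg_neg]; omega⟩
  obtain ⟨z, hz⟩ := exists_hullEdge hσ.neg hc.gen hr hre ⟨r', hr', hne.symm⟩
  rcases hc.color z with hχz | hχz
  · obtain ⟨x, hx, hxb, hχx⟩ := exists_firstBalanced hσ hc.color hc.gen hr hre hχr
      (Finset.filter_subset _ _) (by simp) (filter_before_down hre hr') hK
    exact odd_of_red_neighbor hσ hE hO hc hsum hr hr' hχr hχr' hre hre' hz hχz hxb hχx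
      (Finset.mem_filter.1 hx).2
  · exact odd_of_blue_neighbor hσ.neg hO hc hsum hr hr' hne hχr hχr' hre hre' hz hχz hK'

end Odd

theorem evenGoal_and_oddGoal (G : SimpleGraph Plane) (S : Finset Plane) :
    EvenGoal G S ∧ OddGoal G S := by
  induction S using Finset.strongInduction with
  | H S ih =>
    exact ⟨even_step (fun T hT => (ih T hT).1) fun T hT => (ih T hT).2,
      odd_step (fun T hT => (ih T hT).1) fun T hT => (ih T hT).2⟩

/-! ### Convex-hull boundary in terms of linear functionals -/

theorem genPos_of_inGeneralPosition {S : Finset Plane} (h : InGeneralPosition (S : Set Plane)) :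
    GenPos S := by
  intro p hp q hq t ht hpq hqt hpt h0
  refine h p hp q hq t ht hpq hqt hpt ?_
  have key : ∃ k : ℝ, t 0 - p 0 = k * (q 0 - p 0) ∧ t 1 - p 1 = k * (q 1 - p 1) := by
    have hne : q 0 - p 0 ≠ 0 ∨ q 1 - p 1 ≠ 0 := by
      by_contra hcon
      push Not at hcon
      exact hpq (plane_ext (sub_eq_zero.1 hcon.1).symm (sub_eq_zero.1 hcon.2).symm)
    unfold orient at h0
    rcases hne with hn | hn
    · refine ⟨(t 0 - p 0) / (q 0 - p 0), by field_simp, ?_⟩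
      field_simp
      linarith
    · refine ⟨(t 1 - p 1) / (q 1 - p 1), ?_, by field_simp⟩
      field_simp
      linarith
  obtain ⟨k, h0, h1⟩ := key
  rw [collinear_iff_of_mem (p₀ := p) (by simp)]
  refine ⟨q - p, ?_⟩
  simp only [Set.mem_insert_iff, Set.mem_singleton_iff, forall_eq_or_imp, forall_eq]
  refine ⟨⟨0, by simp⟩, ⟨1, by simp⟩, k, plane_ext ?_ ?_⟩
  · simp [← h0]
  · simp [← h1]

theorem lin_add_smul (a b s t : ℝ) (p q : Plane) :
    lin a b (s • p + t • q) = s * lin a b p + t * lin a b q := by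
  simp [lin]; ring

theorem strongDual_eq_lin (f : StrongDual ℝ Plane) (p : Plane) :
    f p = lin (f (EuclideanSpace.single 0 1)) (f (EuclideanSpace.single 1 1)) p := by
  have h : p = p 0 • EuclideanSpace.single (0 : Fin 2) (1 : ℝ) +
      p 1 • EuclideanSpace.single (1 : Fin 2) (1 : ℝ) := by
    apply plane_ext <;> simp
  conv_lhs => rw [h]
  simp [lin]; ring

theorem convex_lin_le (a b c : ℝ) : Convex ℝ {p | lin a b p ≤ c} := by
  intro p hp q hq s t hs ht hst
  simp only [Set.mem_ofPred_eq] at hp hq ⊢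
  rw [lin_add_smul]
  have := mul_le_mul_of_nonneg_left hp hs
  have := mul_le_mul_of_nonneg_left hq ht
  have hc : c = s * c + t * c := by rw [← add_mul, hst, one_mul]
  linarith

/-- Three points in general position span the plane, so the hull has interior and Hahn–Banach
applies. Two points span a segment, supported by the normal of its line. -/
theorem exists_supporting {S : Finset Plane} (h : InGeneralPosition (S : Set Plane))
    (hcard : 2 ≤ S.card) {p : Plane} (hp : p ∈ frontier (convexHull ℝ (S : Set Plane))) :
    ∃ a b, (a ≠ 0 ∨ b ≠ 0) ∧ ∀ t ∈ S, lin a b t ≤ lin a b p := by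
  have hclosed : IsClosed (convexHull ℝ (S : Set Plane)) :=
    (S.finite_toSet.isCompact_convexHull ℝ).isClosed
  have hpC : p ∈ convexHull ℝ (S : Set Plane) := hclosed.frontier_subset hp
  rcases hcard.lt_or_eq with h3 | h2
  · obtain ⟨x, hx, y, hy, z, hz, hxy, hxz, hyz⟩ := Finset.two_lt_card.1 h3
    have hind := affineIndependent_iff_not_collinear_set.2 (h x hx y hy z hz hxy hyz hxz)
    have hspan : affineSpan ℝ (Set.range ![x, y, z]) = ⊤ := by
      rw [hind.affineSpan_eq_top_iff_card_eq_finrank_add_one]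
      simp
    have hsub : Set.range ![x, y, z] ⊆ (S : Set Plane) := by
      rintro _ ⟨i, rfl⟩
      fin_cases i <;> simp [hx, hy, hz]
    have htop : affineSpan ℝ (S : Set Plane) = ⊤ :=
      top_le_iff.1 (hspan ▸ affineSpan_mono ℝ hsub)
    obtain ⟨f, hf, hle⟩ := geometric_hahn_banach_of_nonempty_interior_point (x := p)
      (convex_convexHull ℝ (S : Set Plane)) hp.2
      (interior_convexHull_nonempty_iff_affineSpan_eq_top.2 htop)
    refine ⟨f (EuclideanSpace.single 0 1), f (EuclideanSpace.single 1 1), ?_, fun t ht => ?_⟩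
    · by_contra hcon
      push Not at hcon
      refine hf (ContinuousLinearMap.ext fun z => ?_)
      rw [strongDual_eq_lin, hcon.1, hcon.2]
      simp [lin]
    · rw [← strongDual_eq_lin, ← strongDual_eq_lin]
      exact hle t (subset_convexHull ℝ _ ht)
  · obtain ⟨x, y, hxy, rfl⟩ := Finset.card_eq_two.1 h2.symm
    have hl := lin_radial 1 x y
    have hly := hl y
    rw [orient_self_right, mul_zero, add_zero] at hly
    refine ⟨_, _, coeff_radial_ne_zero isSense_one hxy.symm, fun t ht => ?_⟩
    have h1 := convexHull_min (s := (({x, y} : Finset Plane) : Set Plane))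
      (t := {z | lin (- -1 * (y 1 - x 1)) (-(1 * (y 0 - x 0))) z ≤
        lin (- -1 * (y 1 - x 1)) (-(1 * (y 0 - x 0))) x}) (by
        intro z hz
        simp only [Finset.coe_insert, Finset.coe_singleton, Set.mem_insert_iff,
          Set.mem_singleton_iff] at hz
        rcases hz with rfl | rfl
        · simp only [Set.mem_ofPred_eq]
          exact le_refl _
        · simp only [Set.mem_ofPred_eq]
          unfold lin at hly ⊢
          linarith) (convex_lin_le _ _ _) hpC
    have h2 : lin (-1 * (y 1 - x 1)) (1 * (y 0 - x 0)) t =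
        lin (-1 * (y 1 - x 1)) (1 * (y 0 - x 0)) x := by
      simp only [Finset.mem_insert, Finset.mem_singleton] at ht
      rcases ht with rfl | rfl
      · rfl
      · exact hly
    rw [h2]
    simp only [Set.mem_ofPred_eq] at h1
    unfold lin at h1 ⊢
    linarith

theorem mem_frontier_of_lin_le {S : Finset Plane} {a b : ℝ} (hab : a ≠ 0 ∨ b ≠ 0) {p : Plane}
    (hp : p ∈ convexHull ℝ (S : Set Plane)) (hle : ∀ t ∈ S, lin a b t ≤ lin a b p) :
    p ∈ frontier (convexHull ℝ (S : Set Plane)) := by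
  refine ⟨subset_closure hp, fun hint => ?_⟩
  have hsub : convexHull ℝ (S : Set Plane) ⊆ {z | lin a b z ≤ lin a b p} :=
    convexHull_min (fun t ht => hle t ht) (convex_lin_le _ _ _)
  have hpos : 0 < lin a b !₂[a, b] := by
    simp only [lin, Matrix.cons_val_zero, Matrix.cons_val_one]
    rcases hab with h | h
    · have := mul_self_pos.2 h
      nlinarith [mul_self_nonneg b]
    · have := mul_self_pos.2 h
      nlinarith [mul_self_nonneg a]
  have hcont : Continuous fun s : ℝ => (1 : ℝ) • p + s • (!₂[a, b] : Plane) := by fun_prop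
  have hev : ∀ᶠ s in nhds (0 : ℝ),
      (1 : ℝ) • p + s • (!₂[a, b] : Plane) ∈ interior (convexHull ℝ (S : Set Plane)) :=
    hcont.continuousAt.eventually (isOpen_interior.mem_nhds (by simpa using hint))
  obtain ⟨s, hs, hs0⟩ := ((hev.filter_mono nhdsWithin_le_nhds).and
    (self_mem_nhdsWithin : Set.Ioi (0 : ℝ) ∈ nhdsWithin 0 (Set.Ioi 0))).exists
  have := hsub (interior_subset hs)
  simp only [Set.mem_ofPred_eq] at this
  rw [lin_add_smul] at this
  have := mul_pos (Set.mem_Ioi.1 hs0) hpos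
  linarith

theorem exists_hullEdge_of_hullNeighbors {S : Finset Plane}
    (h : InGeneralPosition (S : Set Plane)) {p q : Plane} (hpq : HullNeighbors (S : Set Plane) p q) :
    ∃ σ, IsSense σ ∧ HullEdge σ S p q := by
  obtain ⟨hp, hq, hne, hseg, -⟩ := hpq
  have hcard : 2 ≤ S.card := Finset.one_lt_card.2 ⟨p, hp, q, hq, hne⟩
  have hm : (1 / 2 : ℝ) • p + (1 / 2 : ℝ) • q ∈ segment ℝ p q :=
    ⟨1 / 2, 1 / 2, by norm_num, by norm_num, by norm_num, rfl⟩
  -- A line supporting the hull at the midpoint must contain both ends.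
  obtain ⟨a, b, hab, hle⟩ := exists_supporting h hcard (hseg hm)
  rw [lin_add_smul] at hle
  have h1 := hle p hp
  have h2 := hle q hq
  have he : lin a b p = lin a b q := by linarith
  refine hullEdge_of_tie hab hp hq hne he fun t ht htp htq => ?_
  refine lt_of_le_of_tie (genPos_of_inGeneralPosition h) hab hp hq ht hne htq.symm htp.symm he ?_
  have := hle t ht
  linarith

theorem HullEdge.hullNeighbors {σ : ℝ} (hσ : IsSense σ) {S : Finset Plane} {p q : Plane}
    (h : HullEdge σ S p q) : HullNeighbors (S : Set Plane) p q := by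
  have hl := lin_radial (-σ) p q
  have hab := coeff_radial_ne_zero hσ.neg h.2.2.1.symm
  have hlq := hl q
  rw [orient_self_right, mul_zero, add_zero] at hlq
  set a := - -σ * (q 1 - p 1)
  set b := -σ * (q 0 - p 0)
  have hlt : ∀ t ∈ S, t ≠ p → t ≠ q → lin a b t < lin a b p := fun t ht h1 h2 => by
    rw [hl t]
    linarith [h.2.2.2 t ht h1 h2]
  have hle : ∀ t ∈ S, lin a b t ≤ lin a b p := fun t ht => by
    by_cases h1 : t = p
    · rw [h1]
    · by_cases h2 : t = q
      · rw [h2, hlq]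
      · exact (hlt t ht h1 h2).le
  have hseg : ∀ z ∈ segment ℝ p q, lin a b z = lin a b p := by
    rintro z ⟨s, t, -, -, hst, rfl⟩
    rw [lin_add_smul, hlq, ← add_mul, hst, one_mul]
  refine ⟨h.1, h.2.1, h.2.2.1, fun z hz => ?_, fun t ht hto => ?_⟩
  · refine mem_frontier_of_lin_le hab ?_ fun t ht => ?_
    · exact segment_subset_convexHull h.1 h.2.1 hz
    · rw [hseg z hz]; exact hle t ht
  · by_cases h1 : t = p
    · rw [h1, left_mem_openSegment_iff] at hto
      exact h.2.2.1 hto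
    · by_cases h2 : t = q
      · rw [h2, right_mem_openSegment_iff] at hto
        exact h.2.2.1 hto
      · exact (hlt t ht h1 h2).ne (hseg t (openSegment_subset_segment ℝ p q hto))

theorem mem_hullPoints_iff {S : Finset Plane} (h : InGeneralPosition (S : Set Plane))
    (hcard : 2 ≤ S.card) {p : Plane} :
    p ∈ hullPoints (S : Set Plane) ↔ p ∈ S ∧ Extreme S p := by
  constructor
  · rintro ⟨hp, hfr⟩
    refine ⟨hp, ?_⟩
    obtain ⟨a, b, hab, hle⟩ := exists_supporting h hcard hfr
    by_cases htie : ∃ t ∈ S, t ≠ p ∧ lin a b t = lin a b p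
    · obtain ⟨t, ht, htp, he⟩ := htie
      obtain ⟨σ, -, hedge⟩ := hullEdge_of_tie hab hp ht htp.symm he.symm fun z hz h1 h2 =>
        lt_of_le_of_tie (genPos_of_inGeneralPosition h) hab hp ht hz htp.symm h2.symm h1.symm
          he.symm (hle z hz)
      exact hedge.extreme_left
    · push Not at htie
      exact ⟨a, b, fun t ht htp => lt_of_le_of_ne (hle t ht) (htie t ht htp)⟩
  · rintro ⟨hp, a, b, hlt⟩
    refine ⟨hp, ?_⟩
    obtain ⟨y, hy, hyp⟩ := Finset.exists_mem_ne (by omega : 1 < S.card) p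
    refine mem_frontier_of_lin_le (coeff_ne_zero_of_lin_lt (hlt y hy hyp))
      (subset_convexHull ℝ _ hp) fun t ht => ?_
    by_cases htp : t = p
    · rw [htp]
    · exact (hlt t ht htp).le

/-! ### Runs as exits from a colour class -/

section Runs

variable {S : Finset Plane} {C : Set Plane}

theorem runGraph_adj_iff (h : InGeneralPosition (S : Set Plane))
    {u v : {p : Plane // p ∈ hullPoints (S : Set Plane) ∧ p ∈ C}} :
    (runGraph (S : Set Plane) C).Adj u v ↔ HullEdge 1 S u v ∨ HullEdge 1 S v u := by
  constructor
  · intro hadj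
    obtain ⟨σ, hσ | hσ, he⟩ := exists_hullEdge_of_hullNeighbors h hadj
    · exact Or.inl (hσ ▸ he)
    · right
      rw [hσ] at he
      exact hullEdge_neg.1 he
  · rintro (he | he)
    · exact he.hullNeighbors isSense_one
    · exact (he.hullNeighbors isSense_one).symm

/-- Walking along the hull from a point of `C` one leaves `C`, if the hull is not contained
in `C`. -/
theorem exists_exit (h : InGeneralPosition (S : Set Plane)) (hcard : 2 ≤ S.card) {r : Plane}
    (hr : r ∈ S) (hre : Extreme S r) (hrC : r ∉ C)
    (u : {p : Plane // p ∈ hullPoints (S : Set Plane) ∧ p ∈ C}) :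
    ∃ e : {p : Plane // p ∈ hullPoints (S : Set Plane) ∧ p ∈ C},
      (∃ q, q ∉ C ∧ HullEdge 1 S e q) ∧
      Relation.ReflTransGen (fun u v : {p : Plane // p ∈ hullPoints (S : Set Plane) ∧ p ∈ C} =>
        HullEdge 1 S u v) u e := by
  have hS := genPos_of_inGeneralPosition h
  induction hn : (S.filter fun t => 0 < (1 : ℝ) * orient r u t).card using Nat.strong_induction_on
    generalizing u with
  | _ n ih =>
    have hu := (mem_hullPoints_iff h hcard).1 u.2.1
    have hur : (u : Plane) ≠ r := fun he => hrC (he ▸ u.2.2)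
    obtain ⟨q, hq⟩ := exists_hullEdge isSense_one hS hu.1 hu.2 ⟨r, hr, hur.symm⟩
    by_cases hqC : q ∈ C
    · have hqr : q ≠ r := fun he => hrC (he ▸ hqC)
      -- Around the outside point `r` each hull step advances in the radial order, so the number of
      -- later points decreases and the walk terminates.
      have huq : 0 < (1 : ℝ) * orient r u q := by
        rw [orient_rotate]; exact hq.2.2.2 r hr hur.symm hqr.symm
      let v : {p : Plane // p ∈ hullPoints (S : Set Plane) ∧ p ∈ C} :=
        ⟨q, (mem_hullPoints_iff h hcard).2 ⟨hq.2.1, hq.extreme_right⟩, hqC⟩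
      have hlt : (S.filter fun t => 0 < (1 : ℝ) * orient r v t).card < n := by
        rw [← hn]
        refine Finset.card_lt_card ((Finset.ssubset_iff_of_subset fun t ht => ?_).2 ⟨q, ?_, ?_⟩)
        · rw [Finset.mem_filter] at ht ⊢
          exact ⟨ht.1, before_trans hre hu.1 hq.2.1 ht.1 huq ht.2⟩
        · exact Finset.mem_filter.2 ⟨hq.2.1, huq⟩
        · simp [v]
      obtain ⟨e, he, hve⟩ := ih _ hlt v rfl
      exact ⟨e, he, Relation.ReflTransGen.head hq hve⟩
    · exact ⟨u, ⟨q, hqC, hq⟩, Relation.ReflTransGen.refl⟩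

/-- A backward step is undone by the forward step that follows it, since hull successors are unique.
It cannot be the last one, because the successor of `e` lies outside `C`. -/
theorem reflTransGen_of_reachable (h : InGeneralPosition (S : Set Plane))
    {u e : {p : Plane // p ∈ hullPoints (S : Set Plane) ∧ p ∈ C}}
    (he : ∃ q, q ∉ C ∧ HullEdge 1 S e q) (hue : (runGraph (S : Set Plane) C).Reachable u e) :
    Relation.ReflTransGen (fun u v : {p : Plane // p ∈ hullPoints (S : Set Plane) ∧ p ∈ C} =>
      HullEdge 1 S u v) u e := by
  rw [SimpleGraph.reachable_iff_reflTransGen] at hue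
  induction hue using Relation.ReflTransGen.head_induction_on with
  | refl => exact Relation.ReflTransGen.refl
  | @head u c huc _ ih =>
    rcases (runGraph_adj_iff h).1 huc with hs | hs
    · exact Relation.ReflTransGen.head hs ih
    · rcases Relation.ReflTransGen.cases_head ih with hc | ⟨d, hcd, hde⟩
      · obtain ⟨q, hq, heq⟩ := he
        rw [hc] at hs
        exact absurd (hs.unique heq ▸ u.2.2) hq
      · have : d = u := Subtype.ext (HullEdge.unique hcd hs)
        exact this ▸ hde

/-- The runs of colour `C` correspond to the hull edges along which one leaves `C`. -/
theorem numRuns_eq_card (h : InGeneralPosition (S : Set Plane)) (hcard : 2 ≤ S.card) {r : Plane}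
    (hr : r ∈ S) (hre : Extreme S r) (hrC : r ∉ C) :
    numRuns (S : Set Plane) C =
      ((S ×ˢ S).filter fun e => e.1 ∈ C ∧ e.2 ∉ C ∧ HullEdge 1 S e.1 e.2).card := by
  set E := (S ×ˢ S).filter fun e => e.1 ∈ C ∧ e.2 ∉ C ∧ HullEdge 1 S e.1 e.2 with hE
  have hmem : ∀ e : E, (e : Plane × Plane).1 ∈ C ∧ (e : Plane × Plane).2 ∉ C ∧
      HullEdge 1 S (e : Plane × Plane).1 (e : Plane × Plane).2 := fun e =>
    (Finset.mem_filter.1 e.2).2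
  let φ : E → {p : Plane // p ∈ hullPoints (S : Set Plane) ∧ p ∈ C} := fun e =>
    ⟨(e : Plane × Plane).1, (mem_hullPoints_iff h hcard).2
      ⟨(hmem e).2.2.1, (hmem e).2.2.extreme_left⟩, (hmem e).1⟩
  have hφ : ∀ e, ∃ q, q ∉ C ∧ HullEdge 1 S (φ e) q := fun e => ⟨_, (hmem e).2.1, (hmem e).2.2⟩
  have hbij : Function.Bijective fun e => (runGraph (S : Set Plane) C).connectedComponentMk (φ e) := by
    constructor
    · intro e e' hee
      have hreach := SimpleGraph.ConnectedComponent.eq.1 hee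
      have hstep := reflTransGen_of_reachable h (hφ e') hreach
      have h1 : φ e = φ e' := by
        rcases Relation.ReflTransGen.cases_head hstep with hc | ⟨d, hd, -⟩
        · exact hc
        · obtain ⟨q, hq, heq⟩ := hφ e
          exact absurd (HullEdge.unique hd heq ▸ d.2.2) hq
      have h1' : (e : Plane × Plane).1 = (e' : Plane × Plane).1 := congrArg Subtype.val h1
      have h2' : (e : Plane × Plane).2 = (e' : Plane × Plane).2 := by
        have := (hmem e').2.2
        rw [← h1'] at this
        exact (hmem e).2.2.unique this
      exact Subtype.ext (Prod.ext h1' h2')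
    · intro c
      induction c using SimpleGraph.ConnectedComponent.ind with
      | _ u =>
        obtain ⟨e, ⟨q, hq, heq⟩, hue⟩ := exists_exit h hcard hr hre hrC u
        refine ⟨⟨((e : Plane), q), Finset.mem_filter.2 ⟨Finset.mem_product.2 ⟨heq.1, heq.2.1⟩,
          e.2.2, hq, heq⟩⟩, ?_⟩
        refine SimpleGraph.ConnectedComponent.eq.2 (SimpleGraph.Reachable.symm ?_)
        rw [SimpleGraph.reachable_iff_reflTransGen]
        exact Relation.ReflTransGen.mono (fun a b hab => (runGraph_adj_iff h).2 (Or.inl hab)) _ _ hue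
  unfold numRuns
  rw [← Nat.card_eq_of_bijective _ hbij, Nat.card_eq_fintype_card, Fintype.card_coe]

end Runs

/-! ### Translation to colourings and conclusion -/

/-- The colouring with the value `1` on `R` and `-1` elsewhere. -/
noncomputable def coloring (R : Set Plane) : Plane → ℤ := fun p => if p ∈ R then 1 else -1

theorem isColoring_coloring (R : Set Plane) : IsColoring (coloring R) := by
  intro p
  unfold coloring
  split_ifs <;> simp

theorem coloring_eq_one {R : Set Plane} {p : Plane} : coloring R p = 1 ↔ p ∈ R := by
  unfold coloring
  split_ifs with h <;> simp [h]

theorem coloring_eq_neg_one {R : Set Plane} {p : Plane} : coloring R p = -1 ↔ p ∉ R := by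
  unfold coloring
  split_ifs with h <;> simp [h]

theorem sum_coloring {R B : Set Plane} (hRB : Disjoint R B) {T : Finset Plane}
    (hT : ∀ p ∈ T, p ∈ R ∪ B) :
    ∑ p ∈ T, coloring R p = (((T : Set Plane) ∩ R).ncard : ℤ) - (((T : Set Plane) ∩ B).ncard : ℤ) := by
  have h1 : (T : Set Plane) ∩ R = ((T.filter (· ∈ R) : Finset Plane) : Set Plane) := by
    ext p; simp
  have h2 : (T : Set Plane) ∩ B = ((T.filter (· ∉ R) : Finset Plane) : Set Plane) := by
    ext p
    simp only [Set.mem_inter_iff, Finset.mem_coe, Finset.mem_filter]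
    refine and_congr_right fun hp => ⟨fun hb hr => Set.disjoint_left.1 hRB hr hb, fun hr => ?_⟩
    exact (hT p hp).resolve_left hr
  rw [h1, h2, Set.ncard_coe_finset, Set.ncard_coe_finset]
  unfold coloring
  rw [Finset.sum_ite]
  simp
  ring

theorem FirstBalanced.isFirstBalanced {R B : Set Plane} (hRB : Disjoint R B) {S : Finset Plane}
    (hS : (S : Set Plane) = R ∪ B) {σ : ℝ} {before : Plane → Plane → Plane → Prop}
    (hb : ∀ x p q, before x p q ↔ 0 < σ * orient x p q) {x q : Plane} (hx : x ∈ S)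
    (h : FirstBalanced σ (coloring R) S x q) : IsFirstBalanced R B before x q := by
  have hmem : ∀ p, p ∈ S ↔ p ∈ R ∪ B := fun p => by rw [← hS, Finset.mem_coe]
  have hset : ∀ y, radialInitial (R ∪ B) before x y = (radialSet σ S x y : Set Plane) := by
    intro y
    ext p
    simp only [radialInitial, Set.mem_ofPred_eq, Finset.mem_coe, mem_radialSet, hb, ← hmem]
    constructor
    · rintro (rfl | ⟨h1, -, h2⟩)
      · exact ⟨hx, Or.inl rfl⟩
      · tauto
    · rintro ⟨h1, h2⟩
      by_cases hpx : p = x <;> tauto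
  have hbal : ∀ y, EquallyColored R B (radialInitial (R ∪ B) before x y) ↔
      ∑ p ∈ radialSet σ S x y, coloring R p = 0 := by
    intro y
    rw [sum_coloring hRB fun p hp => (hmem p).1 (radialSet_subset _ _ _ _ hp), ← hset y]
    unfold EquallyColored
    omega
  refine ⟨(hmem q).1 h.1, h.2.1, (hbal q).2 h.2.2.1, fun p hp hpx hbp => ?_⟩
  rw [hbal]
  exact h.2.2.2 p ((hmem p).2 hp) hpx ((hb x p q).1 hbp)

theorem Special.isSpecial {R B : Set Plane} (hRB : Disjoint R B) {S : Finset Plane}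
    (hS : (S : Set Plane) = R ∪ B) (hgen : InGeneralPosition (R ∪ B)) {r b : Plane} (hr : r ∈ S)
    (hb : b ∈ S) (h : Special (coloring R) S r b) : IsSpecial R B r b := by
  have hccw : ∀ x p q, CcwBefore x p q ↔ 0 < (1 : ℝ) * orient x p q := fun x p q => by
    simp [CcwBefore]
  have hcw : ∀ x p q, CwBefore x p q ↔ 0 < (-1 : ℝ) * orient x p q := fun x p q => by
    simp [CwBefore]
  have hgen' : InGeneralPosition (S : Set Plane) := hS ▸ hgen
  refine ⟨fun p hp => ?_, fun p hp => ?_,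
    (h.around_red 1 isSense_one).isFirstBalanced hRB hS hccw hr,
    (h.around_red (-1) isSense_one.neg).isFirstBalanced hRB hS hcw hr,
    (h.around_blue 1 isSense_one).isFirstBalanced hRB hS hccw hb,
    (h.around_blue (-1) isSense_one.neg).isFirstBalanced hRB hS hcw hb⟩
  · obtain ⟨σ, hσ, he⟩ := exists_hullEdge_of_hullNeighbors hgen' (hS ▸ hp)
    exact coloring_eq_one.1 (h.red_neighbors σ hσ p he)
  · have hpS := hp.2.1
    obtain ⟨σ, hσ, he⟩ := exists_hullEdge_of_hullNeighbors hgen' (hS ▸ hp)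
    exact hpS.resolve_left (coloring_eq_neg_one.1 (h.blue_neighbors σ hσ p he))

theorem config_coloring {R B : Set Plane} {S : Finset Plane}
    (hS : (S : Set Plane) = R ∪ B) (hgen : InGeneralPosition (R ∪ B)) :
    Config (bichromaticGraph R B) (coloring R) S := by
  have hmem : ∀ p, p ∈ S ↔ p ∈ R ∪ B := fun p => by rw [← hS, Finset.mem_coe]
  refine ⟨isColoring_coloring R, genPos_of_inGeneralPosition (hS ▸ hgen), fun p hp q hq hne => ?_⟩
  have hpq : p ≠ q := by rintro rfl; exact hne rfl
  have hp' := (hmem p).1 hp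
  have hq' := (hmem q).1 hq
  rw [bichromaticGraph, SimpleGraph.between_adj]
  refine ⟨hpq, ?_⟩
  rcases isColoring_coloring R p with h1 | h1 <;> rcases isColoring_coloring R q with h2 | h2
  · exact absurd (h1.trans h2.symm) hne
  · exact Or.inl ⟨coloring_eq_one.1 h1, hq'.resolve_left (coloring_eq_neg_one.1 h2)⟩
  · exact Or.inr ⟨hp'.resolve_left (coloring_eq_neg_one.1 h1), coloring_eq_one.1 h2⟩
  · exact absurd (h1.trans h2.symm) hne

/-- The red hull point rules out an all-blue hull, which would be one run without any exit. -/
theorem numRuns_blue {R B : Set Plane} (hRB : Disjoint R B) {S : Finset Plane}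
    (hS : (S : Set Plane) = R ∪ B) (hgen : InGeneralPosition (R ∪ B)) (hcard : 2 ≤ S.card)
    {r : Plane} (hr : r ∈ S) (hre : Extreme S r) (hrR : r ∈ R) :
    numRuns (R ∪ B) B = tau 1 (coloring R) S := by
  have hmem : ∀ p, p ∈ S → (p ∈ B ↔ p ∉ R) := fun p hp => by
    have hp' : p ∈ R ∪ B := by rwa [← hS, Finset.mem_coe]
    exact ⟨fun hb hr => Set.disjoint_left.1 hRB hr hb, hp'.resolve_left⟩
  rw [← hS, numRuns_eq_card (hS ▸ hgen) hcard hr hre (Set.disjoint_left.1 hRB hrR)]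
  unfold tau
  congr 1
  refine Finset.filter_congr fun e he => ?_
  rw [Finset.mem_product] at he
  rw [coloring_eq_one, coloring_eq_neg_one, hmem _ he.1, hmem _ he.2, not_not]

/-- Exits from red are the changes from red to blue, equal in number to those from blue to red. -/
theorem numRuns_red {R B : Set Plane} (hRB : Disjoint R B) {S : Finset Plane}
    (hS : (S : Set Plane) = R ∪ B) (hgen : InGeneralPosition (R ∪ B)) (hcard : 2 ≤ S.card)
    {b : Plane} (hb : b ∈ S) (hbe : Extreme S b) (hbB : b ∈ B) :
    numRuns (R ∪ B) R = tau 1 (coloring R) S := by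
  have hgen' : InGeneralPosition (S : Set Plane) := hS ▸ hgen
  rw [← tau_neg_coloring isSense_one (isColoring_coloring R) (genPos_of_inGeneralPosition hgen'),
    ← hS, numRuns_eq_card hgen' hcard hb hbe (Set.disjoint_right.1 hRB hbB)]
  unfold tau
  congr 1
  refine Finset.filter_congr fun e he => ?_
  rw [Pi.neg_apply, Pi.neg_apply, neg_inj, coloring_eq_one, ← coloring_eq_neg_one, neg_eq_iff_eq_neg]

theorem HasPath.exists_isOnePHAP {R B : Set Plane} {S : Finset Plane}
    (hS : (S : Set Plane) = R ∪ B) {x y : Plane} {k : ℕ}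
    (h : HasPath (bichromaticGraph R B) S x y k) :
    ∃ w : (bichromaticGraph R B).Walk x y, IsOnePHAP w ∧ numCrossings {e | e ∈ w.edges} ≤ k := by
  obtain ⟨w, h1, h2, h3, h4⟩ := h
  exact ⟨w, ⟨h1, fun p => by rw [h2, ← hS, Finset.mem_coe], h3⟩, h4⟩

end AlternatingPath

open AlternatingPath in
theorem lemma2 (R B : Set Plane) (hR : R.Finite) (hB : B.Finite) (hRB : Disjoint R B)
    (hgen : InGeneralPosition (R ∪ B)) (r : Plane) (hr : r ∈ R) (hrS : r ∈ hullPoints (R ∪ B)) :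
    (∀ n : ℕ, 1 ≤ n → R.ncard = n → B.ncard = n →
      ∀ b ∈ B, b ∈ hullPoints (R ∪ B) → ¬ IsSpecial R B r b →
        numRuns (R ∪ B) R = numRuns (R ∪ B) B ∧
        ∃ w : (bichromaticGraph R B).Walk r b,
          IsOnePHAP w ∧ numCrossings {e | e ∈ w.edges} + numRuns (R ∪ B) R ≤ n) ∧
    (∀ n : ℕ, 1 ≤ n → R.ncard = n + 1 → B.ncard = n →
      ∀ r' ∈ R, r' ≠ r → r' ∈ hullPoints (R ∪ B) →
        ∃ w : (bichromaticGraph R B).Walk r r',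
          IsOnePHAP w ∧ numCrossings {e | e ∈ w.edges} + numRuns (R ∪ B) B ≤ n) := by
  obtain ⟨S, hS⟩ : ∃ S : Finset Plane, (S : Set Plane) = R ∪ B :=
    ⟨(hR.union hB).toFinset, by simp⟩
  have hmem : ∀ p, p ∈ S ↔ p ∈ R ∪ B := fun p => by rw [← hS, Finset.mem_coe]
  have hgen' : InGeneralPosition (S : Set Plane) := hS ▸ hgen
  have hcard : S.card = R.ncard + B.ncard := by
    rw [← Set.ncard_union_eq hRB hR hB, ← hS, Set.ncard_coe_finset]
  have hsum : ∑ p ∈ S, coloring R p = (R.ncard : ℤ) - B.ncard := by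
    rw [sum_coloring hRB fun p hp => (hmem p).1 hp, hS, Set.union_inter_cancel_left,
      Set.union_inter_cancel_right]
  have hc := config_coloring hS hgen
  have hrS' : r ∈ S := (hmem r).2 (Or.inl hr)
  obtain ⟨hE, hO⟩ := evenGoal_and_oddGoal (bichromaticGraph R B) S
  have hext : 2 ≤ S.card → ∀ p, p ∈ hullPoints (R ∪ B) → Extreme S p := fun h2 p hp =>
    ((mem_hullPoints_iff hgen' h2).1 (hS ▸ hp)).2
  constructor
  · intro n hn hRn hBn b hb hbS hns
    have h2 : 2 ≤ S.card := by omega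
    have hbS' : b ∈ S := (hmem b).2 (Or.inr hb)
    have hre := hext h2 r hrS
    have hbe := hext h2 b hbS
    rw [numRuns_red hRB hS hgen h2 hbS' hbe hb, numRuns_blue hRB hS hgen h2 hrS' hre hr]
    refine ⟨rfl, ?_⟩
    obtain ⟨k, hk, hk'⟩ := hE _ hc (by rw [hsum, hRn, hBn, sub_self]) r hrS' b hbS'
      (coloring_eq_one.2 hr) (coloring_eq_neg_one.2 (Set.disjoint_right.1 hRB hb)) hre hbe
      fun hs => hns (hs.isSpecial hRB hS hgen hrS' hbS')
    obtain ⟨w, hw, hw'⟩ := hk.exists_isOnePHAP hS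
    exact ⟨w, hw, by omega⟩
  · intro n hn hRn hBn r' hr' hne hrS''
    have h2 : 2 ≤ S.card := by omega
    have hre := hext h2 r hrS
    rw [numRuns_blue hRB hS hgen h2 hrS' hre hr]
    obtain ⟨k, hk, hk'⟩ := hO _ hc (by rw [hsum, hRn, hBn]; push_cast; ring) r hrS' r'
      ((hmem r').2 (Or.inl hr')) hne.symm (coloring_eq_one.2 hr) (coloring_eq_one.2 hr') hre
      (hext h2 r' hrS'')
    obtain ⟨w, hw, hw'⟩ := hk.exists_isOnePHAP hS
    exact ⟨w, hw, by omega⟩
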